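/- **Setting.** Let $r$ be the number of antennas of node B (node A has one), let $L_c$ be the coherence time and $L_{A,\tau_1},L_{B,\tau},L_{A,\tau_2}\ge 1$ the training durations in symbols, and put $$\alpha=\frac{L_c-L_{B,\tau}-L_{A,\tau_1}-L_{A,\tau_2}}{L_c}.$$ The channel $\mathbf h\in\mathbb C^r$, the noises $\mathbf w_1,\mathbf w_2,\mathbf w_3\in\mathbb C^r$ and $w_A\in\mathbb C$, and the data symbol $x\in\mathbb C$ are independent with i.i.d. $\mathcal{CN}(0,1)$ entries. Let $\bar P$ be the average power, $R_{\bar P}>0$ (for all large $\bar P$) the target rate in nats, with multiplexing gain $g_m=\lim_{\bar P\to\infty}R_{\bar P}/\log\bar P$, and let $c>0$, $\kappa_{\bar P}>0$. The protocol is as follows. * Phase I: node B receives $\mathbf y_1=\sqrt{\bar PL_{A,\tau_1}}\,\mathbf h+\mathbf w_1$ and forms $\hat{\mathbf h}=\mathbb E[\mathbf h\mid\mathbf y_1]$, $\hat{\mathbf v}=\hat{\mathbf h}/\|\hat{\mathbf h}\|$. * Phase II: node A receives $y_A=\sqrt{\bar PL_{B,\tau}}\,\mathbf h^H\hat{\mathbf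 v}+w_A$ and forms $\hat\sigma=\Re\{y_A\}/\sqrt{\bar PL_{B,\tau}}$. It uses the normalized power $$\mathcal P(\hat\sigma)=\begin{cases}c\,\bar P^{\,l}, & \hat\sigma\le \bar P^{-1/2},\\[2pt] \kappa_{\bar P}\,\dfrac{\exp(R_{\bar P}/\alpha)-1}{\hat\sigma^{2s}}, & \hat\sigma>\bar P^{-1/2}.\end{cases}$$ * Phase III: with $\mathbf p_c=\sqrt{\mathcal P(\hat\sigma)}\,\mathbf h$, node B receives $\sqrt{\bar PL_{A,\tau_2}}\,\mathbf p_c+\mathbf w_2$. It divides this by $\sqrt{\bar PL_{A,\tau_2}}$ to get $\tilde{\mathbf y}$, and forms $\hat{\mathbf p}_c=\mathbb E[\mathbf p_c\mid\tilde{\mathbf y}]$ and $\tilde{\mathbf p}_c=\mathbf p_c-\hat{\mathbf p}_c$. * Phase IV: node B receives the data $\mathbf y_d=\sqrt{\bar P\,\mathcal P(\hat\sigma)}\,\mathbf h\,x+\mathbf w_3$. Let $I(x;\mathbf y_d\mid\hat{\mathbf p}_c)$ be the mutual information given the realized value of $\hat{\mathbf p}_c$, and let $$C_{AB}=\alpha\log\left(1+\frac{\bar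 P\|\hat{\mathbf p}_c\|^2}{\frac{\bar P}{r}\,\mathbb E[\|\tilde{\mathbf p}_c\|^2\mid\tilde{\mathbf y}]+1}\right)$$ be the rate of the worst-case-noise bound. **Theorem 2.** Let $0\le l\le r$, $1\le s<r$ and $0\le g_m<\alpha$. Then there are $c>0$, with $c=1$ if $l<r$, and $\kappa_{\bar P}$ such that, for all large $\bar P$, $\kappa_{\bar P}>0$ and $\mathbb E[\mathcal P(\hat\sigma)]=1$ (average transmit power $\bar P$), and such that the protocol achieves the diversity order $$d(g_m)=r\left(\min\{l,s\}+1-\frac{g_m}{\alpha}\right).$$ That is, $\liminf_{\bar P\to\infty}\left(-\log P_{out}/\log\bar P\right)\ge d(g_m)$, both for $P_{out}=\Pr\{C_{AB}<R_{\bar P}\}$ and for $P_{out}=\Pr\{\alpha\, I(x;\mathbf y_d\mid\hat{\mathbf p}_c)<R_{\bar P}\}$. -/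

import Mathlib

open MeasureTheory ProbabilityTheory Filter Topology
open scoped ENNReal

namespace ThreeWay

noncomputable section

/-- `ℂ^r` with the Euclidean norm. -/
abbrev CVec (r : ℕ) : Type := EuclideanSpace ℂ (Fin r)

/-- The circularly symmetric complex Gaussian law `CN(0, 1)`: the real and the imaginary part are
independent real Gaussians with mean `0` and variance `1 / 2`. -/
def cn : Measure ℂ :=
  ((gaussianReal 0 (1 / 2)).prod (gaussianReal 0 (1 / 2))).map fun p => (⟨p.1, p.2⟩ : ℂ)

/-- The law of a vector in `ℂ^r` whose entries are i.i.d. `CN(0, 1)`. -/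
def cnVec (r : ℕ) : Measure (CVec r) :=
  (Measure.pi fun _ : Fin r => cn).map (WithLp.toLp 2)

/-- The random quantities of one coherence block. -/
structure Signals (r : ℕ) (Ω : Type*) where
  /-- forward channel -/
  h : Ω → CVec r
  /-- noise at node B in phase I -/
  w₁ : Ω → CVec r
  /-- noise at node A in phase II -/
  wA : Ω → ℂ
  /-- noise at node B in phase III -/
  w₂ : Ω → CVec r
  /-- data symbol sent by node A in phase IV -/
  x : Ω → ℂ
  /-- noise at node B in phase IV -/
  w₃ : Ω → CVec r

/-- Rayleigh fading, additive white Gaussian noise and Gaussian signalling: the channel, the noises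
and the data symbol are independent, with i.i.d. `CN(0, 1)` entries. -/
structure Signals.IsRayleigh {r : ℕ} {Ω : Type*} [MeasurableSpace Ω] (S : Signals r Ω)
    (μ : Measure Ω) : Prop where
  measurable_h : Measurable S.h
  measurable_w₁ : Measurable S.w₁
  measurable_wA : Measurable S.wA
  measurable_w₂ : Measurable S.w₂
  measurable_x : Measurable S.x
  measurable_w₃ : Measurable S.w₃
  law : μ.map (fun ω => (S.h ω, S.w₁ ω, S.wA ω, S.w₂ ω, S.x ω, S.w₃ ω)) =
    (cnVec r).prod ((cnVec r).prod (cn.prod ((cnVec r).prod (cn.prod (cnVec r)))))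

/-- The parameters of the protocol, at all average powers `P`. -/
structure Params where
  /-- coherence time, in symbols -/
  Lc : ℕ
  /-- training duration of phase I (forward) -/
  L₁ : ℕ
  /-- training duration of phase II (reverse) -/
  LB : ℕ
  /-- training duration of phase III (forward) -/
  L₂ : ℕ
  /-- power exponent used when the channel estimate is below the threshold -/
  l : ℝ
  /-- channel inversion exponent used when the channel estimate is above the threshold -/
  s : ℝ
  /-- constant scaling factor of the power used below the threshold -/
  c : ℝ
  /-- power normalization `κ_P` -/
  κ : ℝ → ℝ
  /-- target data rate `R_P`, in nats per symbol -/
  R : ℝ → ℝ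

/-- The fraction `α` of the coherence time that is left for data. -/
def dataFraction (Lc L₁ LB L₂ : ℕ) : ℝ :=
  ((Lc : ℝ) - (LB : ℝ) - (L₁ : ℝ) - (L₂ : ℝ)) / (Lc : ℝ)

/-- The minimum mean square error estimate of `X` from the observation `Y`. -/
def mmse {Ω E F : Type*} [MeasurableSpace Ω] [NormedAddCommGroup E] [NormedSpace ℝ E]
    [CompleteSpace E] [MeasurableSpace F] (μ : Measure Ω) (X : Ω → E) (Y : Ω → F) : Ω → E :=
  condExp (MeasurableSpace.comap Y inferInstance) μ X

/-- The mutual information (in nats) of the two components of a random pair with law `ρ`. -/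
def mutualInfo {A B : Type*} [MeasurableSpace A] [MeasurableSpace B] (ρ : Measure (A × B)) : ℝ≥0∞ :=
  InformationTheory.klDiv ρ (ρ.fst.prod ρ.snd)

/-- The mutual information `I(X; Y | T = t)`. -/
def condMutualInfo {Ω A B C : Type*} [MeasurableSpace Ω]
    [MeasurableSpace A] [StandardBorelSpace A] [Nonempty A]
    [MeasurableSpace B] [StandardBorelSpace B] [Nonempty B] [MeasurableSpace C]
    (μ : Measure Ω) [IsFiniteMeasure μ] (X : Ω → A) (Y : Ω → B) (T : Ω → C) (t : C) : ℝ≥0∞ :=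
  mutualInfo (condDistrib (fun ω => (X ω, Y ω)) T μ t)

/-- The diversity order `- lim log (p P) / log P` of a family of probabilities (as a limit
inferior, with values in the extended reals and `log 0 = -∞`). -/
def diversityOrder (p : ℝ → ℝ≥0∞) : EReal :=
  liminf (fun P : ℝ => -(ENNReal.log (p P)) / ((Real.log P : ℝ) : EReal)) atTop

section Protocol

variable {r : ℕ} {Ω : Type*} [MeasurableSpace Ω] (μ : Measure Ω) (S : Signals r Ω) (Q : Params)
  (P : ℝ)

/-- The fraction `α` of the coherence time that is left for data. -/
def Params.α : ℝ := dataFraction Q.Lc Q.L₁ Q.LB Q.L₂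

/-- Phase I: fixed-power forward training, as received at node B. -/
def y₁ (ω : Ω) : CVec r :=
  ((Real.sqrt (P * Q.L₁) : ℝ) : ℂ) • S.h ω + S.w₁ ω

/-- The estimate `ĥ` of the channel at node B. -/
def hHat : Ω → CVec r := mmse μ S.h (y₁ S Q P)

/-- The estimated channel direction `v̂ = ĥ / ‖ĥ‖` at node B. -/
def vHat (ω : Ω) : CVec r := ((‖hHat μ S Q P ω‖⁻¹ : ℝ) : ℂ) • hHat μ S Q P ω

/-- The channel-dependent reverse training signal of node B. -/
def xB (ω : Ω) : CVec r := ((Real.sqrt (P * Q.LB) : ℝ) : ℂ) • vHat μ S Q P ω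

/-- Phase II: reverse training, as received at node A (`inner ℂ h x = hᴴ x`). -/
def yA (ω : Ω) : ℂ := inner ℂ (S.h ω) (xB μ S Q P ω) + S.wA ω

/-- The estimate `σ̂` of `‖h‖` at node A. -/
def sigmaHat (ω : Ω) : ℝ := (yA μ S Q P ω).re / Real.sqrt (P * Q.LB)

/-- The channel inversion function `Φ`. -/
def Φ (u : ℝ) : ℝ := (Real.exp (Q.R P / Q.α) - 1) / u

/-- The power control function, with threshold `1 / √P`. -/
def power (t : ℝ) : ℝ :=
  if t ≤ 1 / Real.sqrt P then Q.c * P ^ Q.l else Q.κ P * Φ Q P (t ^ (2 * Q.s))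

/-- The power chosen by node A on the basis of its estimate. -/
def txPower (ω : Ω) : ℝ := power Q P (sigmaHat μ S Q P ω)

/-- The composite channel `p_c`. -/
def pc (ω : Ω) : CVec r := ((Real.sqrt (txPower μ S Q P ω) : ℝ) : ℂ) • S.h ω

/-- Phase III: power-controlled forward training, as received at node B. -/
def y₂ (ω : Ω) : CVec r :=
  ((Real.sqrt (P * Q.L₂) * Real.sqrt (txPower μ S Q P ω) : ℝ) : ℂ) • S.h ω + S.w₂ ω

/-- The received training signal of phase III after normalization. -/
def y₂n (ω : Ω) : CVec r := (((Real.sqrt (P * Q.L₂))⁻¹ : ℝ) : ℂ) • y₂ μ S Q P ω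

/-- The estimate of the composite channel at node B. -/
def pcHat : Ω → CVec r := mmse μ (pc μ S Q P) (y₂n μ S Q P)

/-- The error in the estimate of the composite channel. -/
def pcErr (ω : Ω) : CVec r := pc μ S Q P ω - pcHat μ S Q P ω

/-- The conditional mean square error, given the received training signal of phase III. -/
def condErr : Ω → ℝ :=
  condExp (MeasurableSpace.comap (y₂n μ S Q P) inferInstance) μ fun ω => ‖pcErr μ S Q P ω‖ ^ 2

/-- Phase IV: power-controlled data, as received at node B. -/
def yd (ω : Ω) : CVec r :=
  ((Real.sqrt (P * txPower μ S Q P ω) : ℝ) : ℂ) • (S.x ω • S.h ω) + S.w₃ ω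

/-- The worst-case-noise rate `C_AB`, in nats per symbol. -/
def CAB (ω : Ω) : ℝ :=
  Q.α * Real.log (1 + P * ‖pcHat μ S Q P ω‖ ^ 2 / (P / r * condErr μ S Q P ω + 1))

/-- The probability that the target rate exceeds `C_AB`. -/
def outageCAB : ℝ≥0∞ := μ {ω | CAB μ S Q P ω < Q.R P}

/-- The probability that the target rate exceeds `α · I(x; y | p̂_c)`, the rate supported by
Gaussian signalling given the estimate of the composite channel at node B. -/
def outageMI [IsFiniteMeasure μ] : ℝ≥0∞ :=
  μ {ω | ENNReal.ofReal Q.α *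
      condMutualInfo μ S.x (yd μ S Q P) (pcHat μ S Q P) (pcHat μ S Q P ω) <
    ENNReal.ofReal (Q.R P)}

end Protocol

end

end ThreeWay

/-!
At high power an outage occurs essentially only when the composite channel `p̂_c` is weak, of size
`P ^ ((a - 1) / 2)` where `a = g / α`: the noises, the data symbol and the two estimation errors,
scaled by `√P`, exceed a power `P ^ ε` with superpolynomially small probability. For the
worst-case-noise rate this can be read off from `C_AB`. For the mutual information, the symbol is
estimated linearly from `y_d`, and the Donsker–Varadhan inequality, tested on the event that this
estimate is accurate, bounds the information from below.

The composite channel can be weak only if `‖h‖` is of size `P ^ ((a - 1 - min l s) / 2)`. Below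
the threshold the transmit power is `c P ^ l`; above it, it is at least of order `σ̂ ^ (-2s)`,
and a gain much larger than `P ^ (-1/2)` would be inverted too well. A small ball of radius `ρ`
in `ℂ ^ r` has Gaussian probability `O(ρ ^ (2r))`, which is the claimed diversity. The power
constraint can be met with the prescribed `c` because `σ̂ ≤ 1 / √P` has probability `O(P ^ (-r))`
and `E[σ̂ ^ (-2s); σ̂ > 1 / √P]` stays bounded for `s < r`.
-/

namespace ThreeWay

open Asymptotics

section Gaussian

instance isGaussian_pi {ι : Type*} [Fintype ι] {E : ι → Type*} [∀ i, NormedAddCommGroup (E i)]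
    [∀ i, NormedSpace ℝ (E i)] [∀ i, CompleteSpace (E i)] [∀ i, MeasurableSpace (E i)]
    [∀ i, BorelSpace (E i)] [∀ i, SecondCountableTopology (E i)] (ν : ∀ i, Measure (E i))
    [∀ i, IsGaussian (ν i)] : IsGaussian (Measure.pi ν) := by
  have hind : iIndepFun (fun i (x : ∀ i, E i) => x i) (Measure.pi ν) :=
    iIndepFun_pi (X := fun _ => id) fun _ => aemeasurable_id
  have hlaw : ∀ i, HasGaussianLaw (fun x : ∀ i, E i => x i) (Measure.pi ν) := fun i =>
    ⟨by rw [(measurePreserving_eval ν i).map_eq]; infer_instance⟩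
  simpa using (hind.hasGaussianLaw hlaw).isGaussian_map

lemma cn_eq_map : cn = ((gaussianReal 0 (1 / 2)).prod (gaussianReal 0 (1 / 2))).map
    Complex.equivRealProdCLM.symm := rfl

instance isGaussian_cn : IsGaussian cn := by
  rw [cn_eq_map]
  infer_instance

instance isGaussian_cnVec (r : ℕ) : IsGaussian (cnVec r) :=
  inferInstanceAs (IsGaussian ((Measure.pi fun _ : Fin r => cn).map
    (PiLp.continuousLinearEquiv 2 ℝ fun _ : Fin r => ℂ).symm))

lemma integral_id_cn : ∫ z, z ∂cn = 0 := by
  have hfst := integral_fun_fst (μ := gaussianReal 0 (1 / 2)) (ν := gaussianReal 0 (1 / 2))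
    (fun x : ℝ => x)
  have hsnd := integral_fun_snd (μ := gaussianReal 0 (1 / 2)) (ν := gaussianReal 0 (1 / 2))
    (fun x : ℝ => x)
  simp only [integral_id_gaussianReal, smul_zero] at hfst hsnd
  have hint : Integrable id ((gaussianReal 0 (1 / 2)).prod (gaussianReal 0 (1 / 2))) :=
    IsGaussian.integrable_id
  rw [cn_eq_map, integral_map (by fun_prop) (by fun_prop),
    Complex.equivRealProdCLM.symm.integral_comp_comm]
  rw [show ∫ p, p ∂((gaussianReal 0 (1 / 2)).prod (gaussianReal 0 (1 / 2))) = 0 from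
    Prod.ext ((fst_integral hint).trans hfst) ((snd_integral hint).trans hsnd), map_zero]

lemma measurePreserving_apply_cnVec (r : ℕ) (i : Fin r) :
    MeasurePreserving (fun y : CVec r => y i) (cnVec r) cn := by
  refine ⟨by fun_prop, ?_⟩
  rw [cnVec, Measure.map_map (by fun_prop) (by fun_prop)]
  exact (measurePreserving_eval (fun _ : Fin r => cn) i).map_eq

lemma integral_id_cnVec (r : ℕ) : ∫ y, y ∂cnVec r = 0 := by
  ext i
  have h := (EuclideanSpace.proj (𝕜 := ℂ) i).integral_comp_comm
    (IsGaussian.integrable_id (μ := cnVec r))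
  calc (∫ y, y ∂cnVec r) i = ∫ y, y i ∂cnVec r := h.symm
    _ = ∫ z, z ∂cn := by
      rw [← (measurePreserving_apply_cnVec r i).map_eq, integral_map (by fun_prop) (by fun_prop)]
    _ = 0 := integral_id_cn

lemma gaussianPDF_half_le_one (x : ℝ) : gaussianPDF 0 (1 / 2) x ≤ 1 := by
  rw [gaussianPDF, ENNReal.ofReal_le_one, gaussianPDFReal]
  refine mul_le_one₀ (inv_le_one_of_one_le₀ (Real.one_le_sqrt.2 ?_)) (Real.exp_nonneg _) ?_
  · norm_num
    linarith [Real.pi_gt_three]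
  · exact Real.exp_le_one_iff.2
      (div_nonpos_of_nonpos_of_nonneg (by nlinarith [sq_nonneg (x - 0)]) (by positivity))

lemma gaussianReal_half_le_volume : gaussianReal 0 (1 / 2) ≤ volume := by
  rw [gaussianReal_of_var_ne_zero _ (by norm_num)]
  calc volume.withDensity (gaussianPDF 0 (1 / 2)) ≤ volume.withDensity 1 :=
        withDensity_mono (ae_of_all _ gaussianPDF_half_le_one)
    _ = volume := withDensity_one

lemma cn_le_volume : cn ≤ volume := by
  rw [← Complex.volume_preserving_equiv_real_prod.symm.map_eq]
  exact Measure.map_mono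
    (Measure.prod_mono gaussianReal_half_le_volume gaussianReal_half_le_volume)
    Complex.volume_preserving_equiv_real_prod.symm.measurable

lemma cn_closedBall_le (a : ℂ) (t : ℝ) :
    cn (Metric.closedBall a t) ≤ ENNReal.ofReal t ^ 2 * NNReal.pi :=
  (cn_le_volume _).trans_eq (Complex.volume_closedBall a t)

lemma cnVec_closedBall_zero_le (r : ℕ) (t : ℝ) :
    cnVec r (Metric.closedBall 0 t) ≤ (ENNReal.ofReal t ^ 2 * NNReal.pi) ^ r := by
  rw [cnVec, Measure.map_apply (by fun_prop) Metric.isClosed_closedBall.measurableSet]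
  calc _ ≤ (Measure.pi fun _ : Fin r => cn) (Set.univ.pi fun _ => Metric.closedBall 0 t) := by
        refine measure_mono fun y hy i _ => ?_
        rw [Set.mem_preimage, mem_closedBall_zero_iff] at hy
        exact mem_closedBall_zero_iff.2 ((PiLp.norm_apply_le (WithLp.toLp 2 y) i).trans hy)
    _ = ∏ _i : Fin r, cn (Metric.closedBall 0 t) := Measure.pi_pi _ _
    _ ≤ _ := by
        rw [Finset.prod_const, Finset.card_univ, Fintype.card_fin]
        gcongr
        exact cn_closedBall_le 0 t

end Gaussian

section Probability

variable {Ω : Type*} [MeasurableSpace Ω] {μ : Measure Ω}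

lemma indepFun_of_measurePreserving_prod {A B : Type*} [MeasurableSpace A] [MeasurableSpace B]
    {ν : Measure A} {ν' : Measure B} [IsProbabilityMeasure ν] [IsProbabilityMeasure ν']
    {X : Ω → A} {Y : Ω → B} (h : MeasurePreserving (fun ω => (X ω, Y ω)) μ (ν.prod ν')) :
    IndepFun X Y μ := by
  have hX : MeasurePreserving X μ ν := measurePreserving_fst.comp h
  have hY : MeasurePreserving Y μ ν' := measurePreserving_snd.comp h
  have : IsProbabilityMeasure (μ.map X) := hX.map_eq ▸ inferInstance
  have : IsProbabilityMeasure μ := Measure.isProbabilityMeasure_of_map X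
  rw [indepFun_iff_map_prod_eq_prod_map_map hX.aemeasurable hY.aemeasurable, h.map_eq,
    hX.map_eq, hY.map_eq]

lemma memLp_of_measurePreserving {E : Type*} [NormedAddCommGroup E] [NormedSpace ℝ E]
    [MeasurableSpace E] [BorelSpace E] [SecondCountableTopology E] [CompleteSpace E] {X : Ω → E}
    {ν : Measure E} [IsGaussian ν] (h : MeasurePreserving X μ ν) {p : ℝ≥0∞} (hp : p ≠ ∞) :
    MemLp X p μ :=
  (IsGaussian.memLp_id ν p hp).comp_measurePreserving h

lemma integral_eq_zero_of_measurePreserving {E : Type*} [NormedAddCommGroup E] [NormedSpace ℝ E]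
    [MeasurableSpace E] [BorelSpace E] [SecondCountableTopology E] {X : Ω → E} {ν : Measure E}
    (hν : ∫ x, x ∂ν = 0) (h : MeasurePreserving X μ ν) : ∫ ω, X ω ∂μ = 0 := by
  rw [← h.map_eq, integral_map h.aemeasurable (by fun_prop)] at hν
  exact hν

lemma setLIntegral_Ioi_one_rpow {p : ℝ} (hp : 1 < p) :
    ∫⁻ t in Set.Ioi (1 : ℝ), ENNReal.ofReal (t ^ (-p)) = ENNReal.ofReal (p - 1)⁻¹ := by
  have hint := (integrableOn_Ioi_rpow_iff (s := -p) one_pos).2 (by linarith)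
  rw [← ofReal_integral_eq_lintegral_ofReal hint, integral_Ioi_rpow_of_lt (by linarith) one_pos]
  · rw [Real.one_rpow, neg_div, ← div_neg, one_div]
    congr 2
    ring
  · filter_upwards [self_mem_ae_restrict measurableSet_Ioi] with t ht
    exact Real.rpow_nonneg (one_pos.trans ht).le _

lemma lintegral_rpow_neg_le_of_measure_le [IsProbabilityMeasure μ] {f : Ω → ℝ}
    (hf : Measurable f) (hf0 : ∀ ω, 0 < f ω) {C : ℝ≥0∞} {d q : ℝ} (hq : 0 < q) (hqd : q < d)
    (h : ∀ t > 0, μ {ω | f ω ≤ t} ≤ C * ENNReal.ofReal (t ^ d)) :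
    ∫⁻ ω, ENNReal.ofReal (f ω ^ (-q)) ∂μ ≤ 1 + C * ENNReal.ofReal (d / q - 1)⁻¹ := by
  have htail : ∀ t > 0, μ {ω | t ≤ f ω ^ (-q)} ≤ C * ENNReal.ofReal (t ^ (-(d / q))) := by
    intro t ht
    calc μ {ω | t ≤ f ω ^ (-q)} = μ {ω | f ω ≤ t ^ (-q)⁻¹} := by
          simp only [Real.le_rpow_inv_iff_of_neg (hf0 _) ht (neg_lt_zero.2 hq)]
      _ ≤ C * ENNReal.ofReal ((t ^ (-q)⁻¹) ^ d) := h _ (by positivity)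
      _ = C * ENNReal.ofReal (t ^ (-(d / q))) := by
          rw [← Real.rpow_mul ht.le]
          congr 3
          field_simp
  rw [lintegral_eq_lintegral_meas_le μ (ae_of_all _ fun ω => (Real.rpow_pos_of_pos (hf0 ω) _).le)
    (by fun_prop), ← Set.Ioc_union_Ioi_eq_Ioi zero_le_one]
  refine (lintegral_union_le _ _ _).trans (add_le_add ?_ ?_)
  · calc _ ≤ ∫⁻ _ in Set.Ioc (0 : ℝ) 1, 1 := lintegral_mono fun t => prob_le_one
      _ = 1 := by simp
  · calc _ ≤ ∫⁻ t in Set.Ioi (1 : ℝ), C * ENNReal.ofReal (t ^ (-(d / q))) :=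
          setLIntegral_mono (by fun_prop) fun t ht => htail t (one_pos.trans ht)
      _ = _ := by
          rw [lintegral_const_mul _ (by fun_prop),
            setLIntegral_Ioi_one_rpow ((one_lt_div hq).2 hqd)]

end Probability

section LinearEstimation

variable {Ω E : Type*} [MeasurableSpace Ω] {μ : Measure Ω} [NormedAddCommGroup E]
  [NormedSpace ℝ E] [MeasurableSpace E] [BorelSpace E] [SecondCountableTopology E]
  [CompleteSpace E] {ν : Measure E} [IsGaussian ν] {X W : Ω → E}

lemma indepFun_smul_add_sub_smul (hν : ∫ x, x ∂ν = 0)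
    (h : MeasurePreserving (fun ω => (X ω, W ω)) μ (ν.prod ν)) (a : ℝ) :
    IndepFun (fun ω => a • X ω + W ω) (fun ω => X ω - a • W ω) μ := by
  have hrot : MeasurePreserving (ContinuousLinearMap.rotation (E := E) (Real.arctan a))
      (ν.prod ν) (ν.prod ν) := ⟨by fun_prop, IsGaussian.map_rotation_eq_self hν _⟩
  have hind := indepFun_of_measurePreserving_prod
    (hrot.comp (Measure.measurePreserving_swap.comp h))
  refine (hind.comp (measurable_const_smul √(1 + a ^ 2))
    (measurable_const_smul √(1 + a ^ 2))).congr ?_ ?_ <;>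
  · refine ae_of_all _ fun ω => ?_
    simp only [Function.comp_apply, Real.cos_arctan,
      Real.sin_arctan, Prod.swap_prod_mk]
    match_scalars <;> field_simp

lemma condExp_comap_smul_add_of_indepFun [IsFiniteMeasure μ] {Y Z : Ω → E} (mY : Measurable Y)
    (mZ : Measurable Z) (iY : Integrable Y μ) (iZ : Integrable Z μ) (hind : IndepFun Y Z μ)
    (hZ : ∫ ω, Z ω ∂μ = 0) (a : ℝ) :
    μ[a • Y + Z | MeasurableSpace.comap Y inferInstance] =ᵐ[μ] a • Y := by
  have hY : StronglyMeasurable[MeasurableSpace.comap Y inferInstance] (a • Y) :=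
    (comap_measurable Y).stronglyMeasurable.const_smul a
  filter_upwards [condExp_add (iY.smul a) iZ (MeasurableSpace.comap Y inferInstance),
    condExp_indep_eq mZ.comap_le mY.comap_le (comap_measurable Z).stronglyMeasurable
      hind.symm] with ω hadd hZω
  rw [hadd, Pi.add_apply, hZω, hZ, add_zero,
    condExp_of_stronglyMeasurable mY.comap_le hY (iY.smul a)]

lemma mmse_smul_add_ae_eq (hν : ∫ x, x ∂ν = 0)
    (h : MeasurePreserving (fun ω => (X ω, W ω)) μ (ν.prod ν)) (a : ℝ) :
    mmse μ X (fun ω => a • X ω + W ω) =ᵐ[μ]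
      fun ω => (a / (1 + a ^ 2)) • (a • X ω + W ω) := by
  have hX : MeasurePreserving X μ ν := measurePreserving_fst.comp h
  have hW : MeasurePreserving W μ ν := measurePreserving_snd.comp h
  have mX := hX.measurable
  have mW := hW.measurable
  have iX : Integrable X μ := memLp_one_iff_integrable.1 (memLp_of_measurePreserving hX (by simp))
  have iW : Integrable W μ := memLp_one_iff_integrable.1 (memLp_of_measurePreserving hW (by simp))
  have : IsProbabilityMeasure (μ.map X) := hX.map_eq ▸ inferInstance
  have : IsProbabilityMeasure μ := Measure.isProbabilityMeasure_of_map X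
  set Y : Ω → E := fun ω => a • X ω + W ω
  set Z : Ω → E := fun ω => (1 / (1 + a ^ 2)) • (X ω - a • W ω)
  have hZ : ∫ ω, Z ω ∂μ = 0 := by
    rw [integral_smul, integral_sub iX (iW.fun_smul a), integral_smul,
      integral_eq_zero_of_measurePreserving hν hX, integral_eq_zero_of_measurePreserving hν hW,
      smul_zero, sub_zero, smul_zero]
  have hdecomp : X = (a / (1 + a ^ 2)) • Y + Z := by
    ext ω
    simp only [Y, Z, Pi.add_apply, Pi.smul_apply]
    match_scalars <;> field_simp <;> ring
  calc mmse μ X Y = μ[(a / (1 + a ^ 2)) • Y + Z | MeasurableSpace.comap Y inferInstance] :=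
        congrArg (condExp _ μ) hdecomp
    _ =ᵐ[μ] (a / (1 + a ^ 2)) • Y :=
        condExp_comap_smul_add_of_indepFun (by fun_prop) (by fun_prop) ((iX.smul a).add iW)
          ((iX.sub (iW.smul a)).smul _)
          ((indepFun_smul_add_sub_smul hν h a).comp measurable_id (measurable_const_smul _)) hZ _

end LinearEstimation

namespace Signals.IsRayleigh

variable {r : ℕ} {Ω : Type*} [MeasurableSpace Ω] {μ : Measure Ω} {S : Signals r Ω}

lemma measurePreserving (hS : S.IsRayleigh μ) :
    MeasurePreserving (fun ω => (S.h ω, S.w₁ ω, S.wA ω, S.w₂ ω, S.x ω, S.w₃ ω)) μ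
      ((cnVec r).prod ((cnVec r).prod (cn.prod ((cnVec r).prod (cn.prod (cnVec r)))))) :=
  ⟨hS.measurable_h.prodMk (hS.measurable_w₁.prodMk (hS.measurable_wA.prodMk
    (hS.measurable_w₂.prodMk (hS.measurable_x.prodMk hS.measurable_w₃)))), hS.law⟩

lemma measurePreserving_w₂_x_w₃ (hS : S.IsRayleigh μ) :
    MeasurePreserving (fun ω => (S.w₂ ω, S.x ω, S.w₃ ω)) μ
      ((cnVec r).prod (cn.prod (cnVec r))) :=
  measurePreserving_snd.comp (measurePreserving_snd.comp
    (measurePreserving_snd.comp hS.measurePreserving))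

lemma measurePreserving_w₂ (hS : S.IsRayleigh μ) : MeasurePreserving S.w₂ μ (cnVec r) :=
  measurePreserving_fst.comp hS.measurePreserving_w₂_x_w₃

lemma measurePreserving_x (hS : S.IsRayleigh μ) : MeasurePreserving S.x μ cn :=
  measurePreserving_fst.comp (measurePreserving_snd.comp hS.measurePreserving_w₂_x_w₃)

lemma measurePreserving_w₃ (hS : S.IsRayleigh μ) : MeasurePreserving S.w₃ μ (cnVec r) :=
  measurePreserving_snd.comp (measurePreserving_snd.comp hS.measurePreserving_w₂_x_w₃)

lemma measurePreserving_h_w₁_wA (hS : S.IsRayleigh μ) :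
    MeasurePreserving (fun ω => (S.h ω, S.w₁ ω, S.wA ω)) μ
      ((cnVec r).prod ((cnVec r).prod cn)) :=
  measurePreserving_fst.comp ((measurePreserving_prodAssoc _ _ _).symm.comp
    (((MeasurePreserving.id _).prod (measurePreserving_prodAssoc _ _ _).symm).comp
      hS.measurePreserving))

lemma measurePreserving_h_w₁ (hS : S.IsRayleigh μ) :
    MeasurePreserving (fun ω => (S.h ω, S.w₁ ω)) μ ((cnVec r).prod (cnVec r)) :=
  measurePreserving_fst.comp
    ((measurePreserving_prodAssoc _ _ _).symm.comp hS.measurePreserving_h_w₁_wA)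

lemma measurePreserving_h (hS : S.IsRayleigh μ) : MeasurePreserving S.h μ (cnVec r) :=
  measurePreserving_fst.comp hS.measurePreserving_h_w₁

lemma measurePreserving_wA (hS : S.IsRayleigh μ) : MeasurePreserving S.wA μ cn :=
  measurePreserving_snd.comp (measurePreserving_snd.comp hS.measurePreserving_h_w₁_wA)

lemma indepFun_x (hS : S.IsRayleigh μ) :
    IndepFun (fun ω => (S.h ω, S.w₁ ω, S.wA ω, S.w₂ ω)) S.x μ := by
  have hw₂ := (MeasurePreserving.id (cnVec r)).prod (measurePreserving_fst (μ := cn) (ν := cnVec r))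
  have hwA := (measurePreserving_prodAssoc _ _ _).symm.comp ((MeasurePreserving.id cn).prod hw₂)
  have hw₁ := (measurePreserving_prodAssoc _ _ _).symm.comp
    ((MeasurePreserving.id (cnVec r)).prod hwA)
  have hh := (measurePreserving_prodAssoc _ _ _).symm.comp
    ((MeasurePreserving.id (cnVec r)).prod hw₁)
  exact indepFun_of_measurePreserving_prod (hh.comp hS.measurePreserving)

end Signals.IsRayleigh

section Measurability

variable {r : ℕ} {Ω : Type*} {m : MeasurableSpace Ω} [MeasurableSpace Ω] {μ : Measure Ω}
  {S : Signals r Ω} {Q : Params} {P : ℝ}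

lemma measurable_mmse {E F : Type*} [NormedAddCommGroup E] [NormedSpace ℝ E] [CompleteSpace E]
    [MeasurableSpace E] [BorelSpace E] [MeasurableSpace F] {X : Ω → E} {Y : Ω → F}
    (hY : Measurable[m] Y) : Measurable[m] (mmse μ X Y) :=
  stronglyMeasurable_condExp.measurable.mono hY.comap_le le_rfl

lemma measurable_sigmaHat (hh : Measurable[m] S.h) (hw₁ : Measurable[m] S.w₁)
    (hwA : Measurable[m] S.wA) : Measurable[m] (sigmaHat μ S Q P) := by
  have hHat : Measurable[m] (hHat μ S Q P) := measurable_mmse (by unfold y₁; fun_prop)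
  unfold sigmaHat yA xB vHat
  fun_prop

lemma measurable_power : Measurable (power Q P) := by
  unfold power Φ
  exact measurable_const.ite measurableSet_Iic (by fun_prop)

lemma measurable_txPower (hσ : Measurable[m] (sigmaHat μ S Q P)) :
    Measurable[m] (txPower μ S Q P) :=
  measurable_power.comp hσ

lemma measurable_y₂n (hh : Measurable[m] S.h) (hσ : Measurable[m] (sigmaHat μ S Q P))
    (hw₂ : Measurable[m] S.w₂) : Measurable[m] (y₂n μ S Q P) := by
  have := measurable_txPower hσ
  unfold y₂n y₂
  fun_prop

namespace Signals.IsRayleigh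

lemma measurable_sigmaHat (hS : S.IsRayleigh μ) : Measurable (sigmaHat μ S Q P) :=
  ThreeWay.measurable_sigmaHat hS.measurable_h hS.measurable_w₁ hS.measurable_wA

lemma measurable_txPower (hS : S.IsRayleigh μ) : Measurable (txPower μ S Q P) :=
  ThreeWay.measurable_txPower hS.measurable_sigmaHat

lemma measurable_pc (hS : S.IsRayleigh μ) : Measurable (pc μ S Q P) := by
  have := hS.measurable_h
  have := hS.measurable_txPower (Q := Q) (P := P)
  unfold pc
  fun_prop

lemma measurable_y₂n (hS : S.IsRayleigh μ) : Measurable (y₂n μ S Q P) :=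
  ThreeWay.measurable_y₂n hS.measurable_h hS.measurable_sigmaHat hS.measurable_w₂

lemma measurable_pcHat (hS : S.IsRayleigh μ) : Measurable (pcHat μ S Q P) :=
  measurable_mmse hS.measurable_y₂n

lemma measurable_yd (hS : S.IsRayleigh μ) : Measurable (yd μ S Q P) := by
  have := hS.measurable_h
  have := hS.measurable_x
  have := hS.measurable_w₃
  have := hS.measurable_txPower (Q := Q) (P := P)
  unfold yd
  fun_prop

lemma indepFun_pcHat_x (hS : S.IsRayleigh μ) : IndepFun (pcHat μ S Q P) S.x μ := by
  set U := fun ω => (S.h ω, S.w₁ ω, S.wA ω, S.w₂ ω)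
  have hU : Measurable[MeasurableSpace.comap U inferInstance] U := comap_measurable U
  have hpcHat : Measurable[MeasurableSpace.comap U inferInstance] (pcHat μ S Q P) :=
    measurable_mmse (ThreeWay.measurable_y₂n hU.fst
      (ThreeWay.measurable_sigmaHat hU.fst hU.snd.fst hU.snd.snd.fst) hU.snd.snd.snd)
  rw [IndepFun_iff_Indep]
  exact indep_of_indep_of_le_left ((IndepFun_iff_Indep ..).1 hS.indepFun_x) hpcHat.comap_le

end Signals.IsRayleigh

end Measurability

section ChannelGainEstimate

lemma norm_inv_norm_smul_le {E : Type*} [NormedAddCommGroup E] [NormedSpace ℂ E] (y : E) :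
    ‖((‖y‖⁻¹ : ℝ) : ℂ) • y‖ ≤ 1 := by
  rw [norm_smul, Complex.norm_real, norm_inv, norm_norm]
  exact inv_mul_le_one

lemma norm_sub_le_re_inner_inv_norm_smul {E : Type*} [NormedAddCommGroup E]
    [InnerProductSpace ℂ E] {a : ℝ} (ha : 0 < a) {h w y : E} (hy : y = (a : ℂ) • h + w) :
    ‖h‖ - 2 * ‖w‖ / a ≤ (inner ℂ h (((‖y‖⁻¹ : ℝ) : ℂ) • y)).re := by
  set v : E := ((‖y‖⁻¹ : ℝ) : ℂ) • y
  have hyv : (inner ℂ y v).re = ‖y‖ := by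
    have hyy : (inner ℂ y y).re = ‖y‖ ^ 2 := inner_self_eq_norm_sq (𝕜 := ℂ) y
    rw [inner_smul_right, Complex.re_ofReal_mul, hyy]
    rcases eq_or_ne ‖y‖ 0 with h0 | h0
    · simp [h0]
    · field_simp
  have hsplit : (inner ℂ y v).re = a * (inner ℂ h v).re + (inner ℂ w v).re := by
    conv_lhs => rw [hy]
    rw [inner_add_left, inner_smul_left, Complex.conj_ofReal, Complex.add_re, Complex.re_ofReal_mul]
  have hwv : (inner ℂ w v).re ≤ ‖w‖ :=
    (Complex.re_le_norm _).trans ((norm_inner_le_norm _ _).trans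
      (mul_le_of_le_one_right (norm_nonneg _) (norm_inv_norm_smul_le y)))
  have hah : a * ‖h‖ ≤ ‖y‖ + ‖w‖ := by
    have := norm_sub_le y w
    rwa [hy, add_sub_cancel_right, norm_smul, Complex.norm_real, Real.norm_of_nonneg ha.le,
      ← hy] at this
  rw [sub_le_iff_le_add, ← sub_le_iff_le_add', le_div_iff₀ ha]
  linarith

variable {r : ℕ} {Ω : Type*} [MeasurableSpace Ω] {μ : Measure Ω} {S : Signals r Ω} {Q : Params}
  {P : ℝ}

lemma vHat_ae_eq (hS : S.IsRayleigh μ) (hP : 0 < P) (hL₁ : 1 ≤ Q.L₁) :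
    vHat μ S Q P =ᵐ[μ] fun ω => ((‖y₁ S Q P ω‖⁻¹ : ℝ) : ℂ) • y₁ S Q P ω := by
  set a := √(P * Q.L₁)
  have ha0 : 0 < a := by positivity
  filter_upwards [mmse_smul_add_ae_eq (integral_id_cnVec r) hS.measurePreserving_h_w₁ a] with ω hω
  have hy₁ : y₁ S Q P = fun ω => a • S.h ω + S.w₁ ω := funext fun _ => by
    rw [y₁, Complex.coe_smul]
  have hc : 0 < a / (1 + a ^ 2) := by positivity
  rw [vHat, hHat, hy₁, hω, norm_smul, Real.norm_of_nonneg hc.le, Complex.coe_smul,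
    Complex.coe_smul, smul_smul]
  congr 1
  field_simp

lemma sigmaHat_eq (hP : 0 < P) (hLB : 1 ≤ Q.LB) (ω : Ω) : sigmaHat μ S Q P ω =
    (inner ℂ (S.h ω) (vHat μ S Q P ω)).re + (S.wA ω).re / √(P * Q.LB) := by
  have : 0 < √(P * Q.LB) := by positivity
  rw [sigmaHat, yA, xB, inner_smul_right, Complex.add_re, Complex.re_ofReal_mul, add_div]
  field_simp

lemma abs_wA_re_div_le {Ω : Type*} (S : Signals r Ω) (hP : 0 < P) (hLB : 1 ≤ Q.LB) (ω : Ω) :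
    |(S.wA ω).re / √(P * Q.LB)| ≤ ‖S.wA ω‖ / √P := by
  have hLB' : (1 : ℝ) ≤ Q.LB := by exact_mod_cast hLB
  rw [abs_div, abs_of_nonneg (Real.sqrt_nonneg _)]
  gcongr
  · exact Complex.abs_re_le_norm _
  · exact le_mul_of_one_le_right hP.le hLB'

lemma sigmaHat_le (hP : 0 < P) (hLB : 1 ≤ Q.LB) (ω : Ω) :
    sigmaHat μ S Q P ω ≤ ‖S.h ω‖ + ‖S.wA ω‖ / √P := by
  rw [sigmaHat_eq hP hLB]
  refine add_le_add ?_ ((le_abs_self _).trans (abs_wA_re_div_le S hP hLB ω))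
  calc _ ≤ ‖S.h ω‖ * ‖vHat μ S Q P ω‖ := (Complex.re_le_norm _).trans (norm_inner_le_norm _ _)
    _ ≤ ‖S.h ω‖ := mul_le_of_le_one_right (norm_nonneg _) (norm_inv_norm_smul_le _)

lemma le_sigmaHat_ae (hS : S.IsRayleigh μ) (hP : 0 < P) (hL₁ : 1 ≤ Q.L₁) (hLB : 1 ≤ Q.LB) :
    ∀ᵐ ω ∂μ, ‖S.h ω‖ - 3 * ‖(S.w₁ ω, S.wA ω)‖ / √P ≤ sigmaHat μ S Q P ω := by
  have hL₁' : (1 : ℝ) ≤ Q.L₁ := by exact_mod_cast hL₁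
  filter_upwards [vHat_ae_eq hS hP hL₁] with ω hω
  have hsignal := norm_sub_le_re_inner_inv_norm_smul (a := √(P * Q.L₁)) (by positivity)
    (y₁.eq_1 S Q P ω)
  have hw₁ : 2 * ‖S.w₁ ω‖ / √(P * Q.L₁) ≤ 2 * ‖(S.w₁ ω, S.wA ω)‖ / √P := by
    gcongr
    · exact norm_fst_le (S.w₁ ω, S.wA ω)
    · exact le_mul_of_one_le_right hP.le hL₁'
  have hwA : ‖S.wA ω‖ / √P ≤ ‖(S.w₁ ω, S.wA ω)‖ / √P := by
    gcongr
    exact norm_snd_le (S.w₁ ω, S.wA ω)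
  have hnoise := neg_le_of_abs_le (abs_wA_re_div_le S hP hLB ω)
  rw [sigmaHat_eq hP hLB, hω]
  linarith [show 3 * ‖(S.w₁ ω, S.wA ω)‖ / √P =
    2 * ‖(S.w₁ ω, S.wA ω)‖ / √P + ‖(S.w₁ ω, S.wA ω)‖ / √P by ring]

lemma measure_norm_le_mul_le {B : Type*} [MeasurableSpace B] {ν : Measure B} [SFinite ν]
    {X : Ω → CVec r} {Z : Ω → B} (h : MeasurePreserving (fun ω => (X ω, Z ω)) μ ((cnVec r).prod ν))
    {N : B → ℝ} (hN : Measurable N) {t : ℝ} (ht : 0 ≤ t) :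
    μ {ω | ‖X ω‖ ≤ t * N (Z ω)} ≤
      (∫⁻ z, (ENNReal.ofReal (N z) ^ 2 * NNReal.pi) ^ r ∂ν) * ENNReal.ofReal (t ^ (2 * r : ℝ)) := by
  have hmeas : MeasurableSet {p : CVec r × B | ‖p.1‖ ≤ t * N p.2} :=
    measurableSet_le (by fun_prop) (by fun_prop)
  have hball : ∀ z, cnVec r ((fun y => (y, z)) ⁻¹' {p : CVec r × B | ‖p.1‖ ≤ t * N p.2}) ≤
      (ENNReal.ofReal (N z) ^ 2 * NNReal.pi) ^ r * ENNReal.ofReal (t ^ (2 * r : ℝ)) := by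
    intro z
    calc _ = cnVec r (Metric.closedBall 0 (t * N z)) := by
          congr 1; ext y; simp
      _ ≤ (ENNReal.ofReal (t * N z) ^ 2 * NNReal.pi) ^ r := cnVec_closedBall_zero_le r _
      _ = _ := by
          rw [ENNReal.ofReal_mul ht, show (2 * r : ℝ) = ((2 * r : ℕ) : ℝ) by push_cast; rfl,
            Real.rpow_natCast, ENNReal.ofReal_pow ht]
          ring
  calc μ {ω | ‖X ω‖ ≤ t * N (Z ω)}
      = ((cnVec r).prod ν) {p | ‖p.1‖ ≤ t * N p.2} :=
        h.measure_preimage hmeas.nullMeasurableSet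
    _ = ∫⁻ z, cnVec r ((fun y => (y, z)) ⁻¹' {p : CVec r × B | ‖p.1‖ ≤ t * N p.2}) ∂ν :=
        Measure.prod_apply_symm hmeas
    _ ≤ _ := by
        rw [← lintegral_mul_const _ (by fun_prop)]
        exact lintegral_mono hball

lemma lintegral_ofReal_one_add_norm_pow_lt_top {E : Type*} [NormedAddCommGroup E]
    [NormedSpace ℝ E] [MeasurableSpace E] [BorelSpace E] [SecondCountableTopology E]
    [CompleteSpace E] (ν : Measure E) [IsGaussian ν] {a : ℝ} (ha : 0 ≤ a) (n : ℕ) :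
    ∫⁻ z, ENNReal.ofReal (1 + a * ‖z‖) ^ n ∂ν < ∞ := by
  have hid : MemLp (fun z : E => ‖z‖) n ν :=
    (IsGaussian.memLp_id ν n (ENNReal.natCast_ne_top n)).norm
  have hone : MemLp (fun _ : E => (1 : ℝ)) n ν := memLp_const 1
  have hmem : MemLp (fun z : E => 1 + a * ‖z‖) n ν := hone.add (hid.const_mul a)
  refine lt_of_le_of_lt (lintegral_mono fun z => ?_) hmem.integrable_norm_pow'.lintegral_lt_top
  have hz : 0 ≤ 1 + a * ‖z‖ := by positivity
  rw [Real.norm_of_nonneg hz, ENNReal.ofReal_pow hz]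

lemma exists_measure_sigmaHat_le (hS : S.IsRayleigh μ) : ∃ C : ℝ≥0∞, C ≠ ∞ ∧
    ∀ (Q : Params) (P t : ℝ), 1 ≤ Q.L₁ → 1 ≤ Q.LB → 0 < P → 1 / √P ≤ t →
      μ {ω | sigmaHat μ S Q P ω ≤ t} ≤ C * ENNReal.ofReal (t ^ (2 * r : ℝ)) := by
  refine ⟨∫⁻ z, (ENNReal.ofReal (1 + 3 * ‖z‖) ^ 2 * NNReal.pi) ^ r ∂(cnVec r).prod cn, ?_,
    fun Q P t hL₁ hLB hP ht => ?_⟩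
  · simp only [mul_pow, ← pow_mul]
    rw [lintegral_mul_const _ (by fun_prop)]
    exact ENNReal.mul_ne_top (lintegral_ofReal_one_add_norm_pow_lt_top _ (by simp) _).ne
      (ENNReal.pow_ne_top ENNReal.coe_ne_top)
  · have ht0 : 0 < t := lt_of_lt_of_le (by positivity) ht
    refine le_trans (measure_mono_ae ?_)
      (measure_norm_le_mul_le hS.measurePreserving_h_w₁_wA (N := fun z => 1 + 3 * ‖z‖)
        (by fun_prop) ht0.le)
    filter_upwards [le_sigmaHat_ae hS hP hL₁ hLB] with ω hω hσ
    have hσt : sigmaHat μ S Q P ω ≤ t := hσ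
    have hnoise : 3 * ‖(S.w₁ ω, S.wA ω)‖ / √P ≤ t * (3 * ‖(S.w₁ ω, S.wA ω)‖) := by
      rw [div_eq_mul_one_div, mul_comm]
      gcongr
    change ‖S.h ω‖ ≤ t * (1 + 3 * ‖(S.w₁ ω, S.wA ω)‖)
    linarith

end ChannelGainEstimate

section PowerNormalization

/-- The inversion `t⁻²ˢ` of a channel gain estimate `t`, cut off to `0` at the threshold of the
power control function. -/
noncomputable def truncInv (P s t : ℝ) : ℝ :=
  if t ≤ 1 / √P then 0 else (t ^ (2 * s))⁻¹

lemma measurable_truncInv {P s : ℝ} : Measurable (truncInv P s) :=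
  measurable_const.ite measurableSet_Iic (by fun_prop)

lemma truncInv_pos {P s t : ℝ} (ht : 1 / √P < t) : 0 < truncInv P s t := by
  have ht0 : 0 < t := lt_of_le_of_lt (by positivity) ht
  rw [truncInv, if_neg ht.not_ge]
  positivity

lemma truncInv_nonneg {P s t : ℝ} : 0 ≤ truncInv P s t := by
  by_cases ht : t ≤ 1 / √P
  · rw [truncInv, if_pos ht]
  · exact (truncInv_pos (not_le.1 ht)).le

lemma truncInv_le_max_rpow {P s t : ℝ} : truncInv P s t ≤ max t (1 / √P) ^ (-(2 * s)) := by
  have hP : 0 ≤ 1 / √P := by positivity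
  unfold truncInv
  split_ifs with ht
  · exact Real.rpow_nonneg (hP.trans (le_max_right _ _)) _
  · push Not at ht
    rw [max_eq_left ht.le, Real.rpow_neg (hP.trans ht.le)]

variable {r : ℕ} {Ω : Type*} [MeasurableSpace Ω] {μ : Measure Ω} {S : Signals r Ω}

lemma exists_measureReal_sigmaHat_le_inv_sqrt (hS : S.IsRayleigh μ) : ∃ C > 0,
    ∀ (Q : Params) (P : ℝ), 1 ≤ Q.L₁ → 1 ≤ Q.LB → 0 < P →
      μ.real {ω | sigmaHat μ S Q P ω ≤ 1 / √P} ≤ C * P ^ (-r : ℝ) := by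
  obtain ⟨C, hC, h⟩ := exists_measure_sigmaHat_le hS
  refine ⟨C.toReal + 1, by positivity, fun Q P hL₁ hLB hP => ?_⟩
  have hpow : (1 / √P) ^ (2 * r : ℝ) = P ^ (-r : ℝ) := by
    rw [one_div, Real.sqrt_eq_rpow, ← Real.rpow_neg hP.le, ← Real.rpow_mul hP.le]
    congr 1
    ring
  have hle := ENNReal.toReal_mono (ENNReal.mul_ne_top hC ENNReal.ofReal_ne_top)
    (h Q P _ hL₁ hLB hP le_rfl)
  rw [hpow, ENNReal.toReal_mul, ENNReal.toReal_ofReal (by positivity)] at hle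
  exact hle.trans (by gcongr; linarith)

lemma exists_lintegral_truncInv_le [IsProbabilityMeasure μ] (hS : S.IsRayleigh μ) {s : ℝ}
    (hs : 0 < s) (hsr : s < r) : ∃ C : ℝ≥0∞, C ≠ ∞ ∧
      ∀ (Q : Params) (P : ℝ), 1 ≤ Q.L₁ → 1 ≤ Q.LB → 0 < P →
        ∫⁻ ω, ENNReal.ofReal (truncInv P s (sigmaHat μ S Q P ω)) ∂μ ≤ C := by
  obtain ⟨C, hC, h⟩ := exists_measure_sigmaHat_le hS
  refine ⟨1 + C * ENNReal.ofReal ((2 * r : ℝ) / (2 * s) - 1)⁻¹, by finiteness,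
    fun Q P hL₁ hLB hP => ?_⟩
  have hP' : 0 < 1 / √P := by positivity
  refine (lintegral_mono fun ω => ENNReal.ofReal_le_ofReal truncInv_le_max_rpow).trans
    (lintegral_rpow_neg_le_of_measure_le (hS.measurable_sigmaHat.max measurable_const)
      (fun ω => hP'.trans_le (le_max_right _ _)) (by positivity) (by linarith) fun t _ => ?_)
  by_cases ht : 1 / √P ≤ t
  · refine (measure_mono ?_).trans (h Q P t hL₁ hLB hP ht)
    exact fun ω (hω : max _ _ ≤ t) => show _ ≤ t from (le_max_left _ _).trans hω
  · have hempty : {ω | max (sigmaHat μ S Q P ω) (1 / √P) ≤ t} = ∅ :=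
      Set.eq_empty_of_forall_notMem fun ω hω => ht ((le_max_right _ _).trans hω)
    rw [hempty, measure_empty]
    exact bot_le

lemma exists_integral_truncInv_le [IsProbabilityMeasure μ] (hS : S.IsRayleigh μ) {s : ℝ}
    (hs : 0 < s) (hsr : s < r) : ∃ C > 0,
      ∀ (Q : Params) (P : ℝ), 1 ≤ Q.L₁ → 1 ≤ Q.LB → 0 < P →
        Integrable (fun ω => truncInv P s (sigmaHat μ S Q P ω)) μ ∧
        ∫ ω, truncInv P s (sigmaHat μ S Q P ω) ∂μ ≤ C := by
  obtain ⟨C, hC, h⟩ := exists_lintegral_truncInv_le hS hs hsr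
  refine ⟨C.toReal + 1, by positivity, fun Q P hL₁ hLB hP => ?_⟩
  have h0 : 0 ≤ᵐ[μ] fun ω => truncInv P s (sigmaHat μ S Q P ω) :=
    ae_of_all _ fun ω => truncInv_nonneg
  have hm : AEStronglyMeasurable (fun ω => truncInv P s (sigmaHat μ S Q P ω)) μ :=
    (measurable_truncInv.comp hS.measurable_sigmaHat).aestronglyMeasurable
  refine ⟨⟨hm, ?_⟩, ?_⟩
  · rw [hasFiniteIntegral_iff_ofReal h0]
    exact (h Q P hL₁ hLB hP).trans_lt hC.lt_top
  · rw [integral_eq_lintegral_of_nonneg_ae h0 hm]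
    exact (ENNReal.toReal_mono hC (h Q P hL₁ hLB hP)).trans (by linarith)

lemma integral_pos_of_measureReal_lt_one [IsProbabilityMeasure μ] {f : Ω → ℝ} {A : Set Ω}
    (hA : MeasurableSet A) (hf : Integrable f μ) (hf0 : 0 ≤ f) (hpos : ∀ ω ∉ A, 0 < f ω)
    (h : μ.real A < 1) : 0 < ∫ ω, f ω ∂μ := by
  rw [integral_pos_iff_support_of_nonneg hf0 hf]
  have hsub : Aᶜ ⊆ Function.support f := fun ω hω => (hpos ω hω).ne'
  have hAc : 0 < μ.real Aᶜ := by
    rw [probReal_compl_eq_one_sub hA]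
    linarith
  exact (ENNReal.toReal_pos_iff.1 hAc).1.trans_le (measure_mono hsub)

lemma integral_txPower [IsProbabilityMeasure μ] (hS : S.IsRayleigh μ) {Q : Params} {P : ℝ}
    (hint : Integrable (fun ω => truncInv P Q.s (sigmaHat μ S Q P ω)) μ) :
    ∫ ω, txPower μ S Q P ω ∂μ =
      μ.real {ω | sigmaHat μ S Q P ω ≤ 1 / √P} * (Q.c * P ^ Q.l) +
      Q.κ P * (Real.exp (Q.R P / Q.α) - 1) *
        ∫ ω, truncInv P Q.s (sigmaHat μ S Q P ω) ∂μ := by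
  have hm : MeasurableSet {ω | sigmaHat μ S Q P ω ≤ 1 / √P} :=
    measurableSet_le hS.measurable_sigmaHat measurable_const
  have hsplit : ∀ ω, txPower μ S Q P ω =
      {ω | sigmaHat μ S Q P ω ≤ 1 / √P}.indicator (fun _ => Q.c * P ^ Q.l) ω +
      Q.κ P * (Real.exp (Q.R P / Q.α) - 1) * truncInv P Q.s (sigmaHat μ S Q P ω) := by
    intro ω
    unfold txPower power truncInv Φ Set.indicator
    simp only [Set.mem_ofPred_eq]
    split_ifs <;> ring
  simp_rw [hsplit]
  rw [integral_add ((integrable_const _).indicator hm) (hint.const_mul _), integral_indicator hm,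
    setIntegral_const, smul_eq_mul, integral_const_mul]

lemma exists_mul_rpow_neg_mul_rpow_le_half {C l d : ℝ} (hC : 0 < C) (hld : l ≤ d) :
    ∃ c > 0, (l < d → c = 1) ∧ ∀ᶠ P : ℝ in atTop, C * P ^ (-d) * (c * P ^ l) ≤ 1 / 2 := by
  rcases hld.lt_or_eq with hl | rfl
  · refine ⟨1, one_pos, fun _ => rfl, ?_⟩
    have ht := (tendsto_rpow_neg_atTop (sub_pos.2 hl)).const_mul C
    rw [mul_zero] at ht
    filter_upwards [ht.eventually_le_const one_half_pos, eventually_gt_atTop 0] with P hP hP0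
    rwa [one_mul, mul_assoc, ← Real.rpow_add hP0, neg_add_eq_sub, ← neg_sub]
  · refine ⟨1 / (2 * C), by positivity, fun h => (lt_irrefl _ h).elim, ?_⟩
    filter_upwards [eventually_gt_atTop 0] with P hP0
    rw [Real.rpow_neg hP0.le]
    field_simp
    rfl

lemma exists_normalization [IsProbabilityMeasure μ] (hS : S.IsRayleigh μ)
    {Lc L₁ LB L₂ : ℕ} (hL₁ : 1 ≤ L₁) (hLB : 1 ≤ LB) {l s : ℝ} (hlr : l ≤ r) (hs : 0 < s)
    (hsr : s < r) (hα : 0 < dataFraction Lc L₁ LB L₂) {R : ℝ → ℝ} (hR : ∀ᶠ P in atTop, 0 < R P) :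
    ∃ (c : ℝ) (κ : ℝ → ℝ) (k : ℝ), 0 < c ∧ (l < r → c = 1) ∧ 0 < k ∧
      let Q : Params :=
        { Lc := Lc, L₁ := L₁, LB := LB, L₂ := L₂, l := l, s := s, c := c, κ := κ, R := R }
      ∀ᶠ P in atTop, 0 < κ P ∧ ∫ ω, txPower μ S Q P ω ∂μ = 1 ∧
        k ≤ κ P * (Real.exp (R P / Q.α) - 1) := by
  obtain ⟨C₁, hC₁, hp⟩ := exists_measureReal_sigmaHat_le_inv_sqrt hS
  obtain ⟨C₂, hC₂, hI⟩ := exists_integral_truncInv_le hS hs hsr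
  obtain ⟨c, hc, hc1, hcl⟩ := exists_mul_rpow_neg_mul_rpow_le_half hC₁ hlr
  let Q₀ : Params :=
    { Lc := Lc, L₁ := L₁, LB := LB, L₂ := L₂, l := l, s := s, c := c, κ := 0, R := R }
  let p : ℝ → ℝ := fun P => μ.real {ω | sigmaHat μ S Q₀ P ω ≤ 1 / √P}
  let B : ℝ → ℝ := fun P => ∫ ω, truncInv P s (sigmaHat μ S Q₀ P ω) ∂μ
  refine ⟨c, fun P => (1 - p P * (c * P ^ l)) / ((Real.exp (R P / Q₀.α) - 1) * B P),
    1 / (2 * C₂), hc, hc1, by positivity, ?_⟩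
  intro Q
  have hp0 := (tendsto_rpow_neg_atTop (hs.trans hsr)).const_mul C₁
  rw [mul_zero] at hp0
  filter_upwards [hp0.eventually_lt_const one_pos, hcl, hR, eventually_gt_atTop 0] with
    P hp1 hpc hRP hP
  have hint := (hI Q P hL₁ hLB hP).1
  have hBC : B P ≤ C₂ := (hI Q P hL₁ hLB hP).2
  have hpP : p P ≤ C₁ * P ^ (-r : ℝ) := hp Q P hL₁ hLB hP
  have hpc' : p P * (c * P ^ l) ≤ 1 / 2 := le_trans (by gcongr) hpc
  have hB : 0 < B P := integral_pos_of_measureReal_lt_one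
    (measurableSet_le hS.measurable_sigmaHat measurable_const) hint (fun ω => truncInv_nonneg)
    (fun ω hω => truncInv_pos (not_le.1 hω)) (hpP.trans_lt hp1)
  have hE : 0 < Real.exp (R P / Q₀.α) - 1 := sub_pos.2 (Real.one_lt_exp_iff.2 (div_pos hRP hα))
  have hK : Q.κ P * (Real.exp (R P / Q₀.α) - 1) = (1 - p P * (c * P ^ l)) / B P := by
    simp only [Q]
    field_simp
  refine ⟨div_pos (by linarith) (by positivity), ?_, ?_⟩
  · rw [integral_txPower hS hint]
    change p P * (c * P ^ l) + Q.κ P * (Real.exp (R P / Q₀.α) - 1) * B P = 1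
    rw [hK, div_mul_cancel₀ _ hB.ne', add_sub_cancel]
  · refine le_trans ?_ hK.ge
    rw [← div_div]
    gcongr <;> linarith

end PowerNormalization

section Decay

variable {Ω E : Type*} [MeasurableSpace Ω] {μ : Measure Ω} [NormedAddCommGroup E]

lemma superpolynomialDecay_of_eLpNorm_le {f : ℝ → Ω → E}
    (hf : ∀ P, AEStronglyMeasurable (f P) μ)
    (h : ∀ n : ℕ, 1 ≤ n → ∃ C : ℝ≥0∞, C ≠ ∞ ∧ ∀ᶠ P in atTop, eLpNorm (f P) n μ ≤ C)
    {ε : ℝ} (hε : 0 < ε) :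
    SuperpolynomialDecay atTop id fun P => μ.real {ω | P ^ ε ≤ ‖f P ω‖} := by
  refine (superpolynomialDecay_iff_abs_isBoundedUnder _ tendsto_id).2 fun z => ?_
  set n := ⌈z / ε⌉₊ + 1
  have hzn : (z : ℝ) ≤ ε * n := by
    rw [← div_le_iff₀' hε, Nat.cast_add_one]
    linarith [Nat.le_ceil (z / ε)]
  obtain ⟨C, hC, hle⟩ := h n (Nat.le_add_left 1 _)
  refine isBoundedUnder_of_eventually_le (a := (C ^ n).toReal) ?_
  filter_upwards [hle, eventually_ge_atTop 1] with P hCP hP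
  have hP0 : 0 < P := by positivity
  have hmarkov := mul_meas_ge_le_pow_eLpNorm' μ (p := n) (by simp [n]) (ENNReal.natCast_ne_top n)
    (hf P) (ENNReal.ofReal (P ^ ε))
  simp only [ENNReal.toReal_natCast, ENNReal.rpow_natCast, ← ofReal_norm,
    ENNReal.ofReal_le_ofReal_iff (norm_nonneg _)] at hmarkov
  have hreal := ENNReal.toReal_mono (ENNReal.pow_ne_top hC) (hmarkov.trans (by gcongr))
  rw [ENNReal.toReal_mul, ENNReal.toReal_pow, ENNReal.toReal_ofReal (by positivity)] at hreal
  rw [id, abs_of_nonneg (by positivity)]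
  refine le_trans ?_ hreal
  rw [← Real.rpow_natCast, ← Real.rpow_natCast, ← Real.rpow_mul hP0.le]
  exact mul_le_mul_of_nonneg_right (Real.rpow_le_rpow_of_exponent_le hP hzn) measureReal_nonneg

lemma superpolynomialDecay_of_measurePreserving [NormedSpace ℝ E] [CompleteSpace E]
    [MeasurableSpace E] [BorelSpace E] [SecondCountableTopology E] {ν : Measure E} [IsGaussian ν]
    {X : Ω → E} (hX : MeasurePreserving X μ ν) {ε : ℝ} (hε : 0 < ε) :
    SuperpolynomialDecay atTop id fun P => μ.real {ω | P ^ ε ≤ ‖X ω‖} :=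
  superpolynomialDecay_of_eLpNorm_le (f := fun _ => X)
    (fun _ => hX.measurable.aestronglyMeasurable)
    (fun n _ => ⟨eLpNorm X n μ, (memLp_of_measurePreserving hX (ENNReal.natCast_ne_top n)).2.ne,
      Eventually.of_forall fun _ => le_rfl⟩) hε

lemma superpolynomialDecay_measureReal_mono [IsFiniteMeasure μ] {A B : ℝ → Set Ω}
    (hB : SuperpolynomialDecay atTop id fun P => μ.real (B P))
    (h : ∀ᶠ P in atTop, A P ≤ᵐ[μ] B P) :
    SuperpolynomialDecay atTop id fun P => μ.real (A P) := by
  refine hB.trans_eventually_abs_le ?_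
  filter_upwards [h] with P hP
  simp only [Function.comp_apply, abs_of_nonneg measureReal_nonneg]
  exact ENNReal.toReal_mono (measure_ne_top _ _) (measure_mono_ae hP)

lemma isBigO_rpow_of_superpolynomialDecay {f : ℝ → ℝ} (hf : SuperpolynomialDecay atTop id f)
    (d : ℝ) : f =O[atTop] fun P => P ^ d := by
  refine ((superpolynomialDecay_iff_isBigO f tendsto_id).1 hf ⌊d⌋).trans ?_
  refine IsBigO.of_bound 1 ?_
  filter_upwards [eventually_ge_atTop 1] with P hP
  rw [id, one_mul, ← Real.rpow_intCast, Real.norm_of_nonneg (by positivity),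
    Real.norm_of_nonneg (by positivity)]
  exact Real.rpow_le_rpow_of_exponent_le hP (Int.floor_le d)

lemma le_diversityOrder_of_isBigO {p : ℝ → ℝ≥0∞} (hp : ∀ P, p P ≠ ∞) {d : ℝ}
    (h : ∀ d' < d, (fun P => (p P).toReal) =O[atTop] fun P => P ^ (-d')) :
    (d : EReal) ≤ diversityOrder p := by
  refine EReal.ge_of_forall_gt_iff_ge.1 fun d' hd' => ?_
  obtain ⟨e, hd'e, hed⟩ := exists_between (EReal.coe_lt_coe_iff.1 hd')
  refine le_liminf_of_le (by isBoundedDefault) ?_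
  obtain ⟨C, hC⟩ := (h e hed).bound
  filter_upwards [hC, (tendsto_rpow_atTop (sub_pos.2 hd'e)).eventually_ge_atTop C,
    eventually_gt_atTop 1] with P hle hCP hP1
  have hP : 0 < P := by linarith
  have hlog : 0 < Real.log P := Real.log_pos hP1
  rw [Real.norm_of_nonneg ENNReal.toReal_nonneg, Real.norm_of_nonneg (by positivity)] at hle
  replace hle : p P ≤ ENNReal.ofReal (P ^ (-d')) := by
    rw [ENNReal.le_ofReal_iff_toReal_le (hp P) (by positivity)]
    calc _ ≤ P ^ (e - d') * P ^ (-e) := hle.trans (by gcongr)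
      _ = P ^ (-d') := by rw [← Real.rpow_add hP]; congr 1; ring
  have hle_log : ENNReal.log (p P) ≤ ((-d' * Real.log P : ℝ) : EReal) := by
    rw [← Real.log_rpow hP, ← ENNReal.log_ofReal_of_pos (by positivity)]
    exact ENNReal.log_monotone hle
  rw [EReal.le_div_iff_mul_le (by exact_mod_cast hlog) (EReal.coe_ne_top _), EReal.le_neg]
  refine hle_log.trans_eq ?_
  norm_cast
  ring

end Decay

section CompositeChannelEstimation

variable {r : ℕ} {Ω : Type*} [MeasurableSpace Ω] {μ : Measure Ω} {S : Signals r Ω} {Q : Params}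
  {P : ℝ}

lemma power_le (hs : 0 ≤ Q.s) (hP : 0 < P) (t : ℝ) :
    power Q P t ≤ max (Q.c * P ^ Q.l)
      (|Q.κ P * (Real.exp (Q.R P / Q.α) - 1)| * (1 / √P) ^ (-(2 * Q.s))) := by
  unfold power
  split_ifs with ht
  · exact le_max_left _ _
  · push Not at ht
    have hP' : 0 < 1 / √P := by positivity
    refine le_max_of_le_right ?_
    calc _ = Q.κ P * (Real.exp (Q.R P / Q.α) - 1) * t ^ (-(2 * Q.s)) := by
          rw [Φ, Real.rpow_neg (hP'.trans ht).le]
          ring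
      _ ≤ _ := mul_le_mul (le_abs_self _)
          (Real.rpow_le_rpow_of_nonpos hP' ht.le (by linarith))
          (Real.rpow_nonneg (hP'.trans ht).le _) (abs_nonneg _)

lemma y₂n_eq (hP : 0 < P) (hL₂ : 1 ≤ Q.L₂) :
    y₂n μ S Q P = pc μ S Q P + (√(P * Q.L₂))⁻¹ • S.w₂ := by
  have : 0 < √(P * Q.L₂) := by positivity
  ext1 ω
  simp only [y₂n, y₂, pc, Complex.coe_smul, smul_add, smul_smul, Pi.add_apply, Pi.smul_apply]
  congr 2
  field_simp

lemma condErr_nonneg : ∀ᵐ ω ∂μ, 0 ≤ condErr μ S Q P ω :=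
  condExp_nonneg (ae_of_all _ fun _ => by positivity)

variable [IsProbabilityMeasure μ]

lemma integrable_pc (hS : S.IsRayleigh μ) (hs : 0 ≤ Q.s) (hP : 0 < P) :
    Integrable (pc μ S Q P) μ := by
  have hh : Integrable S.h μ :=
    (memLp_of_measurePreserving hS.measurePreserving_h ENNReal.one_ne_top).integrable le_rfl
  have hT := hS.measurable_txPower (Q := Q) (P := P)
  have hsqrt : Measurable fun ω => ((√(txPower μ S Q P ω) : ℝ) : ℂ) := by fun_prop
  refine hh.bdd_smul (√(max (Q.c * P ^ Q.l)
    (|Q.κ P * (Real.exp (Q.R P / Q.α) - 1)| * (1 / √P) ^ (-(2 * Q.s)))))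
    hsqrt.aestronglyMeasurable (ae_of_all _ fun ω => ?_)
  rw [Complex.norm_real, Real.norm_of_nonneg (Real.sqrt_nonneg _)]
  exact Real.sqrt_le_sqrt (power_le hs hP _)

/-- The estimates of the signal and of the noise add up to the observation, so their errors are
opposite. -/
lemma smul_pcErr_ae_eq (hS : S.IsRayleigh μ) (hs : 0 ≤ Q.s) (hL₂ : 1 ≤ Q.L₂) (hP : 0 < P) :
    (fun ω => √(P * Q.L₂) • pcErr μ S Q P ω) =ᵐ[μ] mmse μ S.w₂ (y₂n μ S Q P) - S.w₂ := by
  set b := √(P * Q.L₂)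
  have hb : b ≠ 0 := by positivity
  have hw : Integrable S.w₂ μ :=
    (memLp_of_measurePreserving hS.measurePreserving_w₂ ENNReal.one_ne_top).integrable le_rfl
  have hpc := integrable_pc hS hs hP
  have hy : y₂n μ S Q P = pc μ S Q P + b⁻¹ • S.w₂ := y₂n_eq hP hL₂
  have hself : mmse μ (y₂n μ S Q P) (y₂n μ S Q P) = y₂n μ S Q P :=
    condExp_of_stronglyMeasurable hS.measurable_y₂n.comap_le
      (comap_measurable _).stronglyMeasurable (hy ▸ hpc.add (hw.smul b⁻¹))
  have hadd : mmse μ (y₂n μ S Q P) (y₂n μ S Q P) =ᵐ[μ]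
      pcHat μ S Q P + mmse μ (b⁻¹ • S.w₂) (y₂n μ S Q P) := by
    have hlin := condExp_add hpc (hw.smul b⁻¹)
      (MeasurableSpace.comap (y₂n μ S Q P) inferInstance)
    rwa [← hy] at hlin
  have hsmul : mmse μ (b⁻¹ • S.w₂) (y₂n μ S Q P) =ᵐ[μ] b⁻¹ • mmse μ S.w₂ (y₂n μ S Q P) :=
    condExp_smul _ _ _
  rw [hself] at hadd
  filter_upwards [hadd, hsmul] with ω hω hsmulω
  have hpcErr : pcErr μ S Q P ω = b⁻¹ • (mmse μ S.w₂ (y₂n μ S Q P) ω - S.w₂ ω) := by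
    rw [Pi.add_apply, hsmulω, hy, Pi.add_apply, ← hy, Pi.smul_apply, Pi.smul_apply] at hω
    rw [pcErr, eq_sub_of_add_eq hω]
    module
  rw [hpcErr, smul_inv_smul₀ hb, Pi.sub_apply]

lemma eLpNorm_smul_pcErr_le (hS : S.IsRayleigh μ) (hs : 0 ≤ Q.s) (hL₂ : 1 ≤ Q.L₂) (hP : 0 < P)
    {p : ℝ≥0∞} (hp : 1 ≤ p) :
    eLpNorm (fun ω => √(P * Q.L₂) • pcErr μ S Q P ω) p μ ≤ 2 * eLpNorm S.w₂ p μ := by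
  have hmmse : Measurable (mmse μ S.w₂ (y₂n μ S Q P)) := measurable_mmse hS.measurable_y₂n
  rw [eLpNorm_congr_ae (smul_pcErr_ae_eq hS hs hL₂ hP), two_mul]
  refine (eLpNorm_sub_le hmmse.aestronglyMeasurable
    hS.measurable_w₂.aestronglyMeasurable hp).trans ?_
  gcongr
  exact eLpNorm_condExp_le_eLpNorm _ hp

lemma eLpNorm_mul_condErr_le (hS : S.IsRayleigh μ) (hs : 0 ≤ Q.s) (hL₂ : 1 ≤ Q.L₂) (hP : 0 < P)
    {p : ℝ≥0∞} (hp : 1 ≤ p) :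
    eLpNorm (fun ω => (P * Q.L₂) * condErr μ S Q P ω) p μ ≤
      (2 * eLpNorm S.w₂ (p * 2) μ) ^ 2 := by
  have hscale : (fun ω => ‖√(P * Q.L₂) • pcErr μ S Q P ω‖ ^ (2 : ℝ)) =
      (P * Q.L₂) • fun ω => ‖pcErr μ S Q P ω‖ ^ 2 := by
    ext1 ω
    rw [Real.rpow_ofNat, norm_smul, mul_pow, Real.norm_of_nonneg (Real.sqrt_nonneg _),
      Real.sq_sqrt (by positivity), Pi.smul_apply, smul_eq_mul]
  have hcond : (fun ω => (P * Q.L₂) * condErr μ S Q P ω) =ᵐ[μ]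
      mmse μ (fun ω => ‖√(P * Q.L₂) • pcErr μ S Q P ω‖ ^ (2 : ℝ)) (y₂n μ S Q P) := by
    rw [hscale]
    exact (condExp_smul (P * Q.L₂ : ℝ) _ _).symm
  rw [eLpNorm_congr_ae hcond]
  refine (eLpNorm_condExp_le_eLpNorm _ hp).trans ?_
  rw [eLpNorm_norm_rpow _ two_pos, ENNReal.rpow_ofNat, ENNReal.ofReal_ofNat]
  gcongr
  exact eLpNorm_smul_pcErr_le hS hs hL₂ hP (hp.trans (le_mul_of_one_le_right' one_le_two))

lemma superpolynomialDecay_pcErr (hS : S.IsRayleigh μ) (hs : 0 ≤ Q.s) (hL₂ : 1 ≤ Q.L₂) {ε : ℝ}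
    (hε : 0 < ε) : SuperpolynomialDecay atTop id fun P =>
      μ.real {ω | P ^ ε ≤ √P * ‖pcErr μ S Q P ω‖} := by
  have hL₂' : (1 : ℝ) ≤ Q.L₂ := by exact_mod_cast hL₂
  have hm : ∀ P, Measurable (pcErr μ S Q P) := fun P => hS.measurable_pc.sub hS.measurable_pcHat
  refine superpolynomialDecay_measureReal_mono (superpolynomialDecay_of_eLpNorm_le
    (f := fun P ω => √(P * Q.L₂) • pcErr μ S Q P ω)
    (fun P => ((hm P).const_smul (√(P * Q.L₂))).aestronglyMeasurable)
    (fun n hn => ⟨2 * eLpNorm S.w₂ n μ, ?_, ?_⟩) hε) ?_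
  · exact ENNReal.mul_ne_top ENNReal.ofNat_ne_top (memLp_of_measurePreserving
      hS.measurePreserving_w₂ (ENNReal.natCast_ne_top n)).2.ne
  · filter_upwards [eventually_gt_atTop 0] with P hP
    exact eLpNorm_smul_pcErr_le hS hs hL₂ hP (by exact_mod_cast hn)
  · filter_upwards [eventually_gt_atTop 0] with P hP
    refine ae_of_all _ fun ω (hω : P ^ ε ≤ √P * ‖pcErr μ S Q P ω‖) => hω.trans ?_
    rw [norm_smul, Real.norm_of_nonneg (Real.sqrt_nonneg _)]
    gcongr
    exact le_mul_of_one_le_right hP.le hL₂'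

lemma superpolynomialDecay_condErr (hS : S.IsRayleigh μ) (hs : 0 ≤ Q.s) (hL₂ : 1 ≤ Q.L₂) {ε : ℝ}
    (hε : 0 < ε) : SuperpolynomialDecay atTop id fun P =>
      μ.real {ω | P ^ ε ≤ P * condErr μ S Q P ω} := by
  have hL₂' : (1 : ℝ) ≤ Q.L₂ := by exact_mod_cast hL₂
  have hm : ∀ P, AEStronglyMeasurable (condErr μ S Q P) μ := fun P =>
    (stronglyMeasurable_condExp.mono hS.measurable_y₂n.comap_le).aestronglyMeasurable
  refine superpolynomialDecay_measureReal_mono (superpolynomialDecay_of_eLpNorm_le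
    (f := fun P ω => (P * Q.L₂) * condErr μ S Q P ω) (fun P => (hm P).const_mul _)
    (fun n hn => ⟨(2 * eLpNorm S.w₂ (n * 2) μ) ^ 2, ?_, ?_⟩) hε) ?_
  · exact ENNReal.pow_ne_top (ENNReal.mul_ne_top ENNReal.ofNat_ne_top (memLp_of_measurePreserving
      hS.measurePreserving_w₂ (by finiteness)).2.ne)
  · filter_upwards [eventually_gt_atTop 0] with P hP
    exact eLpNorm_mul_condErr_le hS hs hL₂ hP (by exact_mod_cast hn)
  · filter_upwards [eventually_gt_atTop 0] with P hP
    filter_upwards [condErr_nonneg (Q := Q) (P := P)] with ω h0 (hω : P ^ ε ≤ P * condErr μ S Q P ω)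
    refine hω.trans (le_trans ?_ (Real.le_norm_self _))
    gcongr
    exact le_mul_of_one_le_right hP.le hL₂'

end CompositeChannelEstimation

section SmallCompositeChannel

lemma le_of_sqrt_mul_rpow_mul_le {P c l ρ B : ℝ} (hP : 0 < P) (hc : 0 < c)
    (h : √(c * P ^ l) * ρ ≤ B) : ρ ≤ (√c)⁻¹ * (P ^ (-l / 2) * B) := by
  have hsqrt : √(c * P ^ l) = √c * P ^ (l / 2) := by
    rw [Real.sqrt_mul hc.le, Real.sqrt_eq_rpow (P ^ l), ← Real.rpow_mul hP.le]
    congr 2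
    ring
  rw [hsqrt] at h
  have : 0 < √c := Real.sqrt_pos.2 hc
  rw [neg_div, Real.rpow_neg hP.le]
  calc ρ = (√c)⁻¹ * ((P ^ (l / 2))⁻¹ * (√c * P ^ (l / 2) * ρ)) := by field_simp
    _ ≤ _ := by gcongr

lemma sqrt_mul_le_rpow_mul {k s σ T ρ B : ℝ} (hk : 0 ≤ k) (hσ : 0 < σ) (hρ : 0 ≤ ρ)
    (hT : k * (σ ^ (2 * s))⁻¹ ≤ T) (h : √T * ρ ≤ B) : √k * ρ ≤ σ ^ s * B := by
  have hsqrt : √k * (σ ^ s)⁻¹ ≤ √T := by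
    refine Real.le_sqrt_of_sq_le (le_of_eq_of_le ?_ hT)
    rw [mul_pow, Real.sq_sqrt hk, inv_pow, mul_comm 2 s, Real.rpow_mul hσ.le, Real.rpow_ofNat]
  calc √k * ρ = σ ^ s * (√k * (σ ^ s)⁻¹ * ρ) := by field_simp
    _ ≤ σ ^ s * (√T * ρ) := by gcongr
    _ ≤ σ ^ s * B := by gcongr

lemma rpow_le_mul_rpow {P ρ s ε : ℝ} (hP : 1 ≤ P) (hε : 0 < ε)
    (hρl : P ^ (ε - 1 / 2) ≤ ρ) (hρu : ρ ≤ P ^ ε) :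
    ρ ^ s ≤ P ^ ((1 - min 1 s) / 2 + s * ε) * ρ := by
  have hP0 : 0 < P := by positivity
  have hρ : 0 < ρ := lt_of_lt_of_le (by positivity) hρl
  suffices ρ ^ (s - 1) ≤ P ^ ((1 - min 1 s) / 2 + s * ε) by
    calc ρ ^ s = ρ ^ (s - 1) * ρ := by rw [← Real.rpow_add_one hρ.ne', sub_add_cancel]
      _ ≤ _ := by gcongr
  rcases le_total 1 s with h1 | h1
  · calc ρ ^ (s - 1) ≤ (P ^ ε) ^ (s - 1) := by gcongr
      _ = P ^ (ε * (s - 1)) := (Real.rpow_mul hP0.le _ _).symm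
      _ ≤ _ := Real.rpow_le_rpow_of_exponent_le hP (by rw [min_eq_left h1]; linarith)
  · calc ρ ^ (s - 1) ≤ (P ^ (ε - 1 / 2)) ^ (s - 1) :=
          Real.rpow_le_rpow_of_nonpos (by positivity) hρl (by linarith)
      _ = P ^ ((ε - 1 / 2) * (s - 1)) := (Real.rpow_mul hP0.le _ _).symm
      _ ≤ _ := Real.rpow_le_rpow_of_exponent_le hP (by rw [min_eq_right h1]; linarith)

/-- Above the threshold, a channel gain `ρ` much larger than the error `P ^ (ε - 1 / 2)` of its
estimate `σ` would be inverted too well for the composite channel to be small. -/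
lemma eventually_le_rpow_of_sqrt_mul_le {s k ε b : ℝ} (hs : 0 < s) (hk : 0 < k) (hε : 0 < ε)
    (hb : (1 - min 1 s) / 2 + s * ε + b < 0) :
    ∀ᶠ P : ℝ in atTop, ∀ ρ σ : ℝ, 0 < σ → ρ ≤ P ^ ε → σ ≤ ρ + P ^ (ε - 1 / 2) →
      √k * ρ ≤ σ ^ s * (2 * P ^ b) → ρ ≤ P ^ (ε - 1 / 2) := by
  have hlim := (tendsto_rpow_neg_atTop (neg_pos.2 hb)).const_mul ((2 : ℝ) ^ s * 2)
  rw [mul_zero, neg_neg] at hlim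
  filter_upwards [hlim.eventually_lt_const (Real.sqrt_pos.2 hk), eventually_ge_atTop 1]
    with P hPk hP ρ σ hσ hρ hσρ h
  by_contra! hlt
  have hP0 : 0 < P := by positivity
  have hρ0 : 0 < ρ := lt_trans (by positivity) hlt
  refine absurd h (not_le.2 ?_)
  calc σ ^ s * (2 * P ^ b) ≤ (2 * ρ) ^ s * (2 * P ^ b) := by gcongr; linarith
    _ = 2 ^ s * 2 * P ^ b * ρ ^ s := by rw [Real.mul_rpow zero_le_two hρ0.le]; ring
    _ ≤ 2 ^ s * 2 * P ^ b * (P ^ ((1 - min 1 s) / 2 + s * ε) * ρ) := by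
        gcongr
        exact rpow_le_mul_rpow hP hε hlt.le hρ
    _ = 2 ^ s * 2 * P ^ ((1 - min 1 s) / 2 + s * ε + b) * ρ := by
        rw [Real.rpow_add hP0 _ b]
        ring
    _ < √k * ρ := by gcongr

lemma exists_le_rpow_of_sqrt_power_mul_le {Q : Params} (hs : 0 < Q.s) (hc : 0 < Q.c) {k : ℝ}
    (hk : 0 < k) (hkP : ∀ᶠ P in atTop, k ≤ Q.κ P * (Real.exp (Q.R P / Q.α) - 1)) {ε b : ℝ}
    (hε : 0 < ε) (hb : (1 - min 1 Q.s) / 2 + Q.s * ε + b < 0) :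
    ∃ C > 0, ∀ᶠ P in atTop, ∀ ρ σ : ℝ, 0 ≤ ρ → ρ ≤ P ^ ε → σ ≤ ρ + P ^ (ε - 1 / 2) →
      √(power Q P σ) * ρ ≤ 2 * P ^ b → ρ ≤ C * P ^ (b - min Q.l Q.s / 2 + Q.s * ε) := by
  have : 0 < √Q.c := Real.sqrt_pos.2 hc
  have : 0 < √k := Real.sqrt_pos.2 hk
  refine ⟨max ((√Q.c)⁻¹ * 2) ((√k)⁻¹ * 2 ^ Q.s * 2), by positivity, ?_⟩
  filter_upwards [hkP, eventually_le_rpow_of_sqrt_mul_le hs hk hε hb, eventually_ge_atTop 1]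
    with P hkP hsmall hP ρ σ hρ hρε hσρ h
  have hP0 : 0 < P := by positivity
  by_cases hσ : σ ≤ 1 / √P
  · rw [power, if_pos hσ] at h
    calc ρ ≤ (√Q.c)⁻¹ * (P ^ (-Q.l / 2) * (2 * P ^ b)) := le_of_sqrt_mul_rpow_mul_le hP0 hc h
      _ = (√Q.c)⁻¹ * 2 * P ^ (-Q.l / 2 + b) := by rw [Real.rpow_add hP0]; ring
      _ ≤ _ := mul_le_mul (le_max_left _ _) (Real.rpow_le_rpow_of_exponent_le hP (by
          nlinarith [min_le_left Q.l Q.s])) (by positivity) (by positivity)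
  · have hσ0 : 0 < σ := lt_trans (by positivity) (not_le.1 hσ)
    have hpower : k * (σ ^ (2 * Q.s))⁻¹ ≤ power Q P σ := by
      rw [power, if_neg hσ, Φ, mul_div_assoc', div_eq_mul_inv]
      gcongr
    have hmul := sqrt_mul_le_rpow_mul hk.le hσ0 hρ hpower h
    have hρ' := hsmall ρ σ hσ0 hρε hσρ hmul
    calc ρ = (√k)⁻¹ * (√k * ρ) := by field_simp
      _ ≤ (√k)⁻¹ * ((2 * P ^ (ε - 1 / 2)) ^ Q.s * (2 * P ^ b)) := by
          refine mul_le_mul_of_nonneg_left (hmul.trans ?_) (by positivity)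
          gcongr
          linarith
      _ = (√k)⁻¹ * 2 ^ Q.s * 2 * P ^ ((ε - 1 / 2) * Q.s + b) := by
          rw [Real.mul_rpow zero_le_two (by positivity), ← Real.rpow_mul hP0.le,
            Real.rpow_add hP0]
          ring
      _ ≤ _ := mul_le_mul (le_max_right _ _) (Real.rpow_le_rpow_of_exponent_le hP (by
          linarith [min_le_right Q.l Q.s])) (by positivity) (by positivity)

variable {r : ℕ} {Ω : Type*} [MeasurableSpace Ω] {μ : Measure Ω} {S : Signals r Ω} {Q : Params}

lemma norm_pc {P : ℝ} (ω : Ω) : ‖pc μ S Q P ω‖ = √(txPower μ S Q P ω) * ‖S.h ω‖ := by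
  rw [pc, norm_smul, Complex.norm_real, Real.norm_of_nonneg (Real.sqrt_nonneg _)]

lemma exists_setOf_norm_pcHat_lt_subset (hLB : 1 ≤ Q.LB) (hs : 0 < Q.s) (hc : 0 < Q.c) {k : ℝ}
    (hk : 0 < k) (hkP : ∀ᶠ P in atTop, k ≤ Q.κ P * (Real.exp (Q.R P / Q.α) - 1)) {ε b : ℝ}
    (hε : 0 < ε) (hεb : ε - 1 / 2 ≤ b) (hb : (1 - min 1 Q.s) / 2 + Q.s * ε + b < 0) :
    ∃ C > 0, ∀ᶠ P in atTop, {ω | ‖pcHat μ S Q P ω‖ < P ^ b} ⊆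
      {ω | P ^ ε ≤ ‖S.h ω‖} ∪ {ω | P ^ ε ≤ ‖S.wA ω‖} ∪ {ω | P ^ ε ≤ √P * ‖pcErr μ S Q P ω‖} ∪
        {ω | ‖S.h ω‖ ≤ C * P ^ (b - min Q.l Q.s / 2 + Q.s * ε)} := by
  obtain ⟨C, hC, hle⟩ := exists_le_rpow_of_sqrt_power_mul_le hs hc hk hkP hε hb
  refine ⟨C, hC, ?_⟩
  filter_upwards [hle, eventually_ge_atTop 1] with P hle hP ω hω
  have hP0 : 0 < P := by positivity
  have hdiv : P ^ ε / √P = P ^ (ε - 1 / 2) := by rw [Real.rpow_sub hP0, Real.sqrt_eq_rpow]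
  simp only [Set.mem_union, Set.mem_ofPred_eq] at hω ⊢
  by_contra! ⟨⟨⟨hh, hwA⟩, herr⟩, hlarge⟩
  refine hlarge.not_ge (hle _ (sigmaHat μ S Q P ω) (norm_nonneg _) hh.le ?_ ?_)
  · refine (sigmaHat_le hP0 hLB ω).trans ?_
    rw [← hdiv]
    gcongr
  · have herr' : ‖pcErr μ S Q P ω‖ ≤ P ^ b := by
      refine le_trans ?_ (Real.rpow_le_rpow_of_exponent_le hP hεb)
      rw [← hdiv, le_div_iff₀' (by positivity)]
      exact herr.le
    have htri : ‖pc μ S Q P ω‖ ≤ ‖pcHat μ S Q P ω‖ + ‖pcErr μ S Q P ω‖ :=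
      norm_le_norm_add_norm_sub' _ _
    rw [← txPower.eq_1, ← norm_pc]
    linarith

lemma isBigO_measureReal_norm_h_le (hS : S.IsRayleigh μ) {C : ℝ} (hC : 0 ≤ C) (e : ℝ) :
    (fun P => μ.real {ω | ‖S.h ω‖ ≤ C * P ^ e}) =O[atTop] fun P => P ^ (2 * r * e) := by
  refine IsBigO.of_bound ((C ^ 2 * Real.pi) ^ r) ?_
  filter_upwards [eventually_gt_atTop 0] with P hP
  have hset : {ω | ‖S.h ω‖ ≤ C * P ^ e} = S.h ⁻¹' Metric.closedBall 0 (C * P ^ e) := by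
    ext ω
    simp
  have hpow : P ^ (2 * r * e) = ((P ^ e) ^ 2) ^ r := by
    rw [← pow_mul, ← Real.rpow_natCast, ← Real.rpow_mul hP.le, Nat.cast_mul, Nat.cast_ofNat,
      mul_comm]
  rw [hset, hS.measurePreserving_h.measureReal_preimage
      Metric.isClosed_closedBall.measurableSet.nullMeasurableSet,
    Real.norm_of_nonneg measureReal_nonneg, Real.norm_of_nonneg (by positivity)]
  calc (cnVec r).real (Metric.closedBall 0 (C * P ^ e))
      ≤ ((ENNReal.ofReal (C * P ^ e) ^ 2 * NNReal.pi) ^ r).toReal :=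
        ENNReal.toReal_mono (by finiteness) (cnVec_closedBall_zero_le r _)
    _ = ((C * P ^ e) ^ 2 * Real.pi) ^ r := by
        rw [ENNReal.toReal_pow, ENNReal.toReal_mul, ENNReal.toReal_pow,
          ENNReal.toReal_ofReal (by positivity), ENNReal.coe_toReal, NNReal.coe_real_pi]
    _ = _ := by
        rw [hpow]
        ring

lemma isBigO_measureReal_norm_pcHat_lt [IsProbabilityMeasure μ] (hS : S.IsRayleigh μ)
    (hLB : 1 ≤ Q.LB) (hL₂ : 1 ≤ Q.L₂) (hs : 0 < Q.s) (hc : 0 < Q.c) {k : ℝ}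
    (hk : 0 < k) (hkP : ∀ᶠ P in atTop, k ≤ Q.κ P * (Real.exp (Q.R P / Q.α) - 1)) {ε b : ℝ}
    (hε : 0 < ε) (hεb : ε - 1 / 2 ≤ b) (hb : (1 - min 1 Q.s) / 2 + Q.s * ε + b < 0) :
    (fun P => μ.real {ω | ‖pcHat μ S Q P ω‖ < P ^ b}) =O[atTop]
      fun P => P ^ (2 * r * (b - min Q.l Q.s / 2 + Q.s * ε)) := by
  obtain ⟨C, hC, hsub⟩ := exists_setOf_norm_pcHat_lt_subset (μ := μ) (S := S) hLB hs hc hk hkP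
    hε hεb hb
  have hdecay := ((superpolynomialDecay_of_measurePreserving hS.measurePreserving_h hε).add
    (superpolynomialDecay_of_measurePreserving hS.measurePreserving_wA hε)).add
    (superpolynomialDecay_pcErr hS hs.le hL₂ hε)
  refine IsBigO.trans (Eventually.isBigO ?_) ((isBigO_rpow_of_superpolynomialDecay hdecay _).add
    (isBigO_measureReal_norm_h_le hS hC.le _))
  filter_upwards [hsub] with P hP
  rw [Real.norm_of_nonneg measureReal_nonneg]
  refine (measureReal_mono hP).trans ((measureReal_union_le _ _).trans ?_)
  gcongr
  refine (measureReal_union_le _ _).trans ?_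
  exact add_le_add (measureReal_union_le _ _) le_rfl

end SmallCompositeChannel

section MutualInformation

open InformationTheory

lemma integral_sub_log_integral_exp_le_klDiv {X : Type*} [MeasurableSpace X] {ρ ν : Measure X}
    [IsProbabilityMeasure ρ] [IsProbabilityMeasure ν] {f : X → ℝ} (hf : Integrable f ρ)
    (hexp : Integrable (fun x => Real.exp (f x)) ν) :
    ENNReal.ofReal (∫ x, f x ∂ρ - Real.log (∫ x, Real.exp (f x) ∂ν)) ≤ klDiv ρ ν := by
  by_cases htop : klDiv ρ ν = ∞
  · exact htop ▸ le_top
  obtain ⟨hac, hint⟩ := klDiv_ne_top_iff.1 htop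
  refine ENNReal.ofReal_le_of_le_toReal ?_
  rw [toReal_klDiv_of_measure_eq hac (by simp)]
  have : IsProbabilityMeasure (ν.tilted f) := isProbabilityMeasure_tilted hexp
  have hac' : ρ ≪ ν.tilted f := hac.trans (absolutelyContinuous_tilted hexp)
  have hnonneg : 0 ≤ ∫ x, llr ρ (ν.tilted f) x ∂ρ := by
    rw [← toReal_klDiv_of_measure_eq hac' (by simp)]
    exact ENNReal.toReal_nonneg
  linarith [integral_llr_tilted_right hac hf hexp hint]

lemma measureReal_mul_sub_log_two_le_klDiv {X : Type*} [MeasurableSpace X] {ρ ν : Measure X}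
    [IsProbabilityMeasure ρ] [IsProbabilityMeasure ν] {A : Set X} (hA : MeasurableSet A) {a : ℝ}
    (ha : Real.exp a * ν.real A ≤ 1) :
    ENNReal.ofReal (ρ.real A * a - Real.log 2) ≤ klDiv ρ ν := by
  have hexp : (fun x => Real.exp (A.indicator (fun _ => a) x)) =
      fun x => A.indicator (fun _ => Real.exp a - 1) x + 1 := by
    ext x
    by_cases hx : x ∈ A <;> simp [hx]
  have hint : Integrable (A.indicator fun _ => Real.exp a - 1) ν :=
    (integrable_const _).indicator hA
  have hintegral : ∫ x, Real.exp (A.indicator (fun _ => a) x) ∂ν =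
      Real.exp a * ν.real A + (1 - ν.real A) := by
    rw [hexp, integral_add hint (integrable_const _), integral_indicator hA, setIntegral_const,
      integral_const, probReal_univ, smul_eq_mul, smul_eq_mul]
    ring
  refine le_trans (ENNReal.ofReal_le_ofReal ?_) (integral_sub_log_integral_exp_le_klDiv
    (f := A.indicator fun _ => a) ((integrable_const a).indicator hA)
    (hexp ▸ hint.add (integrable_const _)))
  rw [hintegral, integral_indicator hA, setIntegral_const, smul_eq_mul]
  have hpos : 0 < Real.exp a * ν.real A + (1 - ν.real A) :=
    hintegral ▸ integral_exp_pos (hexp ▸ hint.add (integrable_const _))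
  gcongr
  linarith [measureReal_nonneg (μ := ν) (s := A)]

lemma le_mutualInfo_of_measureReal_le {B : Type*} [MeasurableSpace B] {ρ : Measure (ℂ × B)}
    [IsProbabilityMeasure ρ] (hρ : ρ.fst = cn) {g : B → ℂ} (hg : Measurable g) {τ a δ : ℝ}
    (hτ : 0 ≤ τ) (ha : 0 ≤ a) (haτ : Real.exp a * (τ ^ 2 * Real.pi) ≤ 1)
    (hδ : ρ.real {q | τ < ‖q.1 - g q.2‖} ≤ δ) :
    ENNReal.ofReal ((1 - δ) * a - Real.log 2) ≤ mutualInfo ρ := by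
  set A : Set (ℂ × B) := {q | τ < ‖q.1 - g q.2‖}ᶜ
  have hA : MeasurableSet A := (measurableSet_lt measurable_const (by fun_prop)).compl
  have hρA : 1 - δ ≤ ρ.real A := by
    rw [probReal_compl_eq_one_sub hA.of_compl]
    linarith
  have hsection (y : B) : (fun x => (x, y)) ⁻¹' A = Metric.closedBall (g y) τ := by
    ext x
    simp [A, dist_eq_norm]
  have hprod : (ρ.fst.prod ρ.snd).real A ≤ τ ^ 2 * Real.pi := by
    refine ENNReal.toReal_le_of_le_ofReal (by positivity) ?_
    rw [Measure.prod_apply_symm hA, hρ]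
    calc ∫⁻ y, cn ((fun x => (x, y)) ⁻¹' A) ∂ρ.snd
        ≤ ∫⁻ _, ENNReal.ofReal τ ^ 2 * NNReal.pi ∂ρ.snd :=
          lintegral_mono fun y => (hsection y).symm ▸ cn_closedBall_le (g y) τ
      _ = ENNReal.ofReal (τ ^ 2 * Real.pi) := by
          rw [lintegral_const, measure_univ, mul_one, ENNReal.ofReal_mul (by positivity),
            ENNReal.ofReal_pow hτ, ← NNReal.coe_real_pi, ENNReal.ofReal_coe_nnreal]
  refine le_trans (ENNReal.ofReal_le_ofReal ?_)
    (measureReal_mul_sub_log_two_le_klDiv (ρ := ρ) hA (le_trans (by gcongr) haτ))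
  gcongr

variable {Ω A B C : Type*} [MeasurableSpace Ω] {μ : Measure Ω} [IsProbabilityMeasure μ]
  [MeasurableSpace A] [StandardBorelSpace A] [Nonempty A]
  [MeasurableSpace B] [StandardBorelSpace B] [Nonempty B] [MeasurableSpace C]

lemma fst_condDistrib_prodMk_ae_eq {X : Ω → A} {Y : Ω → B} {T : Ω → C} (hX : Measurable X)
    (hY : Measurable Y) (hT : Measurable T) (hind : IndepFun T X μ) :
    ∀ᵐ ω ∂μ, (condDistrib (fun ω => (X ω, Y ω)) T μ (T ω)).fst = μ.map X := by
  have : IsProbabilityMeasure (μ.map X) := Measure.isProbabilityMeasure_map hX.aemeasurable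
  have hfst : condDistrib X T μ =ᵐ[μ.map T] (condDistrib (fun ω => (X ω, Y ω)) T μ).map Prod.fst :=
    condDistrib_comp T (hX.prodMk hY).aemeasurable (f := Prod.fst) measurable_fst
  have hconst : condDistrib X T μ =ᵐ[μ.map T] Kernel.const C (μ.map X) := by
    refine condDistrib_ae_eq_of_measure_eq_compProd T hX.aemeasurable ?_
    rw [(indepFun_iff_map_prod_eq_prod_map_map hT.aemeasurable hX.aemeasurable).1 hind,
      Measure.compProd_const]
  refine ae_of_ae_map (p := fun t => (condDistrib (fun ω => (X ω, Y ω)) T μ t).fst = μ.map X)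
    hT.aemeasurable ?_
  filter_upwards [hfst, hconst] with t hfst hconst
  rw [Kernel.map_apply _ measurable_fst] at hfst
  rw [Measure.fst, ← hfst, hconst, Kernel.const_apply]

lemma mul_measure_le_condDistrib_le {X : Ω → A} {T : Ω → C} (hX : Measurable X)
    (hT : Measurable T) {D : Set (C × A)} (hD : MeasurableSet D) (δ : ℝ≥0∞) :
    δ * μ {ω | δ ≤ condDistrib X T μ (T ω) (Prod.mk (T ω) ⁻¹' D)} ≤ μ {ω | (T ω, X ω) ∈ D} := by
  have hmeas : Measurable fun t => condDistrib X T μ t (Prod.mk t ⁻¹' D) :=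
    Kernel.measurable_kernel_prodMk_left hD
  calc δ * μ {ω | δ ≤ condDistrib X T μ (T ω) (Prod.mk (T ω) ⁻¹' D)}
      ≤ ∫⁻ ω, condDistrib X T μ (T ω) (Prod.mk (T ω) ⁻¹' D) ∂μ :=
        mul_meas_ge_le_lintegral (hmeas.comp hT) δ
    _ = ∫⁻ t, condDistrib X T μ t (Prod.mk t ⁻¹' D) ∂μ.map T := (lintegral_map hmeas hT).symm
    _ = μ.map (fun ω => (T ω, X ω)) D := by
        rw [← Measure.compProd_apply hD, compProd_map_condDistrib hX.aemeasurable]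
    _ = μ {ω | (T ω, X ω) ∈ D} := Measure.map_apply (hT.prodMk hX) hD

/-- If the symbol is recovered with accuracy `τ` outside a small event, then by Markov's inequality
most values of `T` leave it recoverable with conditional probability at least `1 - δ`. -/
lemma mul_measureReal_condMutualInfo_lt_le {X : Ω → ℂ} {Y : Ω → B} {T : Ω → C}
    (hX : MeasurePreserving X μ cn) (hY : Measurable Y) (hT : Measurable T) (hind : IndepFun T X μ)
    {g : C → B → ℂ} (hg : Measurable (Function.uncurry g)) {τ a δ : ℝ} (hτ : 0 ≤ τ) (ha : 0 ≤ a)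
    (haτ : Real.exp a * (τ ^ 2 * Real.pi) ≤ 1) (hδ : 0 ≤ δ) :
    δ * μ.real {ω | condMutualInfo μ X Y T (T ω) < ENNReal.ofReal ((1 - δ) * a - Real.log 2)} ≤
      μ.real {ω | τ < ‖X ω - g (T ω) (Y ω)‖} := by
  set D : Set (C × ℂ × B) := {p | τ < ‖p.2.1 - g p.1 p.2.2‖}
  have hD : MeasurableSet D := measurableSet_lt measurable_const
    (measurable_snd.fst.sub (hg.comp (measurable_fst.prodMk measurable_snd.snd))).norm
  have hmarkov := mul_measure_le_condDistrib_le (μ := μ) (hX.measurable.prodMk hY) hT hD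
    (ENNReal.ofReal δ)
  refine le_trans ?_ (ENNReal.toReal_mono (measure_ne_top _ _) hmarkov)
  rw [ENNReal.toReal_mul, ENNReal.toReal_ofReal hδ]
  refine mul_le_mul_of_nonneg_left (ENNReal.toReal_mono (measure_ne_top _ _)
    (measure_mono_ae ?_)) hδ
  filter_upwards [fst_condDistrib_prodMk_ae_eq hX.measurable hY hT hind] with ω hfst
    (hω : condMutualInfo μ X Y T (T ω) < _)
  refine le_of_not_gt fun hlt => hω.not_ge ?_
  refine le_mutualInfo_of_measureReal_le (hfst.trans hX.map_eq) (g := g (T ω))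
    (hg.comp measurable_prodMk_left) hτ ha haτ ?_
  exact ENNReal.toReal_le_of_le_ofReal hδ hlt.le

end MutualInformation

section Outage

lemma rpow_le_mul_sq_div {P a ε ρ e : ℝ} {r : ℕ} (hP : 1 ≤ P) (hε : 0 ≤ ε) (hPε : 2 ≤ P ^ ε)
    (he : 0 ≤ e) (hPe : P * e ≤ P ^ ε) (hρ : P ^ ((a - 1) / 2 + 4 * ε) ≤ ρ) :
    P ^ (a + ε) ≤ P * ρ ^ 2 / (P / r * e + 1) := by
  have hP0 : 0 < P := by positivity
  have hr : P / r ≤ P := by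
    rcases r.eq_zero_or_pos with rfl | hr
    · simpa using hP0.le
    · exact div_le_self hP0.le (mod_cast hr)
  have hden : P / r * e + 1 ≤ P ^ ε * P ^ ε := by
    nlinarith [mul_le_mul_of_nonneg_right hr he]
  rw [le_div_iff₀ (by positivity)]
  calc P ^ (a + ε) * (P / r * e + 1) ≤ P ^ (a + ε) * (P ^ ε * P ^ ε) := by gcongr
    _ = P ^ (a + 3 * ε) := by
        rw [← Real.rpow_add hP0, ← Real.rpow_add hP0]
        ring_nf
    _ ≤ P ^ (1 + ((a - 1) / 2 + 4 * ε) * 2) :=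
        Real.rpow_le_rpow_of_exponent_le hP (by linarith)
    _ = P * (P ^ ((a - 1) / 2 + 4 * ε)) ^ 2 := by
        rw [Real.rpow_add hP0, Real.rpow_one, Real.rpow_mul hP0.le, Real.rpow_ofNat]
    _ ≤ P * ρ ^ 2 := by gcongr

/-- The linear estimate of the data symbol from the received signal `y`, in which `t` is treated as
the true composite channel; it is the decoder behind the bound on the mutual information. -/
noncomputable def symbolEstimate {r : ℕ} (P : ℝ) (t y : CVec r) : ℂ :=
  inner ℂ t y / ((√P * ‖t‖ ^ 2 : ℝ) : ℂ)

lemma measurable_symbolEstimate {r : ℕ} (P : ℝ) :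
    Measurable (Function.uncurry (symbolEstimate (r := r) P)) := by
  refine Measurable.div ?_ ?_ <;> fun_prop

lemma norm_sub_symbolEstimate_le {r : ℕ} {P : ℝ} (hP : 0 < P) {t : CVec r} (ht : 0 < ‖t‖)
    (e w : CVec r) (x : ℂ) :
    ‖x - symbolEstimate P t (((√P : ℝ) : ℂ) • (x • (t + e)) + w)‖ ≤
      (‖x‖ * (√P * ‖e‖) + ‖w‖) / (√P * ‖t‖) := by
  have hsqrt : 0 < √P := Real.sqrt_pos.2 hP
  have herr : x - symbolEstimate P t (((√P : ℝ) : ℂ) • (x • (t + e)) + w) =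
      -inner ℂ t (((√P : ℝ) : ℂ) • (x • e) + w) / ((√P * ‖t‖ ^ 2 : ℝ) : ℂ) := by
    have hsqrt' : ((√P : ℝ) : ℂ) ≠ 0 := Complex.ofReal_ne_zero.2 hsqrt.ne'
    have ht' : ((‖t‖ : ℝ) : ℂ) ≠ 0 := Complex.ofReal_ne_zero.2 ht.ne'
    simp only [symbolEstimate, inner_add_right, inner_smul_right, inner_self_eq_norm_sq_to_K,
      Complex.ofReal_mul, Complex.ofReal_pow, Complex.coe_algebraMap]
    field_simp
    ring
  have hinner : ‖(inner ℂ t (((√P : ℝ) : ℂ) • (x • e) + w) : ℂ)‖ ≤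
      ‖t‖ * (‖x‖ * (√P * ‖e‖) + ‖w‖) := by
    refine (norm_inner_le_norm _ _).trans ?_
    gcongr
    refine (norm_add_le _ _).trans_eq ?_
    rw [norm_smul, norm_smul, Complex.norm_real, Real.norm_of_nonneg hsqrt.le, mul_left_comm]
  rw [herr, norm_div, norm_neg, Complex.norm_real, Real.norm_of_nonneg (by positivity),
    div_le_div_iff₀ (by positivity) (by positivity)]
  calc _ ≤ ‖t‖ * (‖x‖ * (√P * ‖e‖) + ‖w‖) * (√P * ‖t‖) := by gcongr
    _ = _ := by ring

variable {r : ℕ} {Ω : Type*} [MeasurableSpace Ω] {μ : Measure Ω} {S : Signals r Ω} {Q : Params}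

lemma le_CAB (hα : 0 < Q.α) {P a ε : ℝ} (hP : 1 ≤ P) (hε : 0 ≤ ε) (hPε : 2 ≤ P ^ ε)
    (hR : Q.R P / Q.α ≤ (a + ε) * Real.log P) {ω : Ω} (he : 0 ≤ condErr μ S Q P ω)
    (hPe : P * condErr μ S Q P ω ≤ P ^ ε) (hpc : P ^ ((a - 1) / 2 + 4 * ε) ≤ ‖pcHat μ S Q P ω‖) :
    Q.R P ≤ CAB μ S Q P ω := by
  have hP0 : 0 < P := by positivity
  refine (div_le_iff₀' hα).1 (hR.trans ?_)
  rw [← Real.log_rpow hP0]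
  refine Real.log_le_log (by positivity) ?_
  linarith [rpow_le_mul_sq_div (r := r) hP hε hPε he hPe hpc]

lemma yd_eq {P : ℝ} (hP : 0 ≤ P) (ω : Ω) : yd μ S Q P ω =
    ((√P : ℝ) : ℂ) • (S.x ω • (pcHat μ S Q P ω + pcErr μ S Q P ω)) + S.w₃ ω := by
  rw [pcErr, add_sub_cancel, yd, pc, Real.sqrt_mul hP, Complex.ofReal_mul, mul_smul,
    smul_comm (S.x ω)]

lemma setOf_lt_norm_sub_symbolEstimate_subset {P a ε : ℝ} (hP : 1 ≤ P) (hPε : 2 ≤ P ^ ε) :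
    {ω | P ^ (-ε - a / 2) < ‖S.x ω - symbolEstimate P (pcHat μ S Q P ω) (yd μ S Q P ω)‖} ⊆
      {ω | P ^ ε ≤ ‖S.x ω‖} ∪ {ω | P ^ ε ≤ ‖S.w₃ ω‖} ∪ {ω | P ^ ε ≤ √P * ‖pcErr μ S Q P ω‖} ∪
        {ω | ‖pcHat μ S Q P ω‖ < P ^ ((a - 1) / 2 + 4 * ε)} := by
  intro ω hω
  simp only [Set.mem_union, Set.mem_ofPred_eq] at hω ⊢
  by_contra! ⟨⟨⟨hx, hw⟩, herr⟩, hpc⟩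
  have hP0 : 0 < P := by positivity
  have ht : 0 < ‖pcHat μ S Q P ω‖ := lt_of_lt_of_le (by positivity) hpc
  refine hω.not_ge ?_
  rw [yd_eq hP0.le]
  calc ‖S.x ω - symbolEstimate P (pcHat μ S Q P ω) _‖
      ≤ (‖S.x ω‖ * (√P * ‖pcErr μ S Q P ω‖) + ‖S.w₃ ω‖) / (√P * ‖pcHat μ S Q P ω‖) :=
        norm_sub_symbolEstimate_le hP0 ht _ _ _
    _ ≤ (P ^ ε * P ^ ε + P ^ ε * P ^ ε) / (√P * P ^ ((a - 1) / 2 + 4 * ε)) := by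
        gcongr
        nlinarith
    _ = 2 * P ^ (-2 * ε - a / 2) := by
        rw [Real.sqrt_eq_rpow, ← Real.rpow_add hP0, ← Real.rpow_add hP0, ← two_mul,
          mul_div_assoc, ← Real.rpow_sub hP0]
        ring_nf
    _ ≤ P ^ ε * P ^ (-2 * ε - a / 2) := by gcongr
    _ = P ^ (-ε - a / 2) := by
        rw [← Real.rpow_add hP0]
        ring_nf

lemma exp_mul_log_mul_sq_le_one {P a ε : ℝ} (hP : 0 < P) (hPε : Real.pi ≤ P ^ ε) :
    Real.exp ((a + ε) * Real.log P) * ((P ^ (-ε - a / 2)) ^ 2 * Real.pi) ≤ 1 := by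
  rw [mul_comm (a + ε), ← Real.rpow_def_of_pos hP, ← Real.rpow_ofNat, ← Real.rpow_mul hP.le]
  calc _ ≤ P ^ (a + ε) * (P ^ ((-ε - a / 2) * 2) * P ^ ε) := by gcongr
    _ = P ^ (0 : ℝ) := by
        rw [← Real.rpow_add hP, ← Real.rpow_add hP]
        ring_nf
    _ = 1 := Real.rpow_zero P

lemma outageMI_le [IsFiniteMeasure μ] (hα : 0 < Q.α) {P b : ℝ} (hR : Q.R P / Q.α ≤ b) :
    outageMI μ S Q P ≤ μ {ω | condMutualInfo μ S.x (yd μ S Q P) (pcHat μ S Q P)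
      (pcHat μ S Q P ω) < ENNReal.ofReal b} := by
  refine measure_mono fun ω (hω : _ < ENNReal.ofReal (Q.R P)) => ?_
  change condMutualInfo μ S.x (yd μ S Q P) (pcHat μ S Q P) (pcHat μ S Q P ω) < _
  contrapose! hω
  calc ENNReal.ofReal (Q.R P) = ENNReal.ofReal Q.α * ENNReal.ofReal (Q.R P / Q.α) := by
        rw [← ENNReal.ofReal_mul hα.le, mul_div_cancel₀ _ hα.ne']
    _ ≤ _ := by
        gcongr
        exact (ENNReal.ofReal_le_ofReal hR).trans hω

end Outage

section Diversity

lemma eventually_div_le_mul_log {R : ℝ → ℝ} {g α δ : ℝ} (hδ : 0 < δ)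
    (hR : Tendsto (fun P => R P / Real.log P) atTop (𝓝 g)) :
    ∀ᶠ P in atTop, R P / α ≤ (g / α + δ) * Real.log P := by
  have hlim : Tendsto (fun P => R P / Real.log P / α) atTop (𝓝 (g / α)) := hR.div_const α
  filter_upwards [hlim.eventually_le_const (lt_add_of_pos_right (g / α) hδ),
    eventually_gt_atTop 1] with P hle hP
  rwa [div_right_comm, div_le_iff₀ (Real.log_pos hP)] at hle

variable {r : ℕ} {Ω : Type*} [MeasurableSpace Ω] {μ : Measure Ω} [IsProbabilityMeasure μ]
  {S : Signals r Ω} {Q : Params}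

lemma isBigO_toReal_outageCAB (hS : S.IsRayleigh μ) (hL₂ : 1 ≤ Q.L₂) (hs : 0 ≤ Q.s)
    (hα : 0 < Q.α) {a ε e : ℝ} (hε : 0 < ε)
    (hR : ∀ᶠ P in atTop, Q.R P / Q.α ≤ (a + ε) * Real.log P)
    (hpc : (fun P => μ.real {ω | ‖pcHat μ S Q P ω‖ < P ^ ((a - 1) / 2 + 4 * ε)}) =O[atTop]
      fun P => P ^ e) :
    (fun P => (outageCAB μ S Q P).toReal) =O[atTop] fun P => P ^ e := by
  have hdecay := isBigO_rpow_of_superpolynomialDecay (superpolynomialDecay_condErr hS hs hL₂ hε) e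
  refine IsBigO.trans (Eventually.isBigO ?_) (hdecay.add hpc)
  filter_upwards [hR, eventually_ge_atTop 1, (tendsto_rpow_atTop hε).eventually_ge_atTop 2]
    with P hR hP hPε
  rw [Real.norm_of_nonneg ENNReal.toReal_nonneg]
  refine le_trans (ENNReal.toReal_mono (measure_ne_top _ _) (measure_mono_ae ?_))
    (measureReal_union_le _ _)
  filter_upwards [condErr_nonneg (μ := μ) (S := S) (Q := Q) (P := P)] with ω he
    (hω : CAB μ S Q P ω < Q.R P)
  change P ^ ε ≤ P * condErr μ S Q P ω ∨ ‖pcHat μ S Q P ω‖ < P ^ ((a - 1) / 2 + 4 * ε)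
  by_contra! ⟨hPe, hpc⟩
  exact hω.not_ge (le_CAB hα hP hε.le hPε hR he hPe.le hpc)

lemma isBigO_toReal_outageMI (hS : S.IsRayleigh μ) (hL₂ : 1 ≤ Q.L₂) (hs : 0 ≤ Q.s)
    (hα : 0 < Q.α) {a ε e : ℝ} (ha : 0 ≤ a) (hε : 0 < ε) (haε : a + ε ≤ 2)
    (hR : ∀ᶠ P in atTop, Q.R P / Q.α ≤ (a + ε / 4) * Real.log P)
    (hpc : (fun P => μ.real {ω | ‖pcHat μ S Q P ω‖ < P ^ ((a - 1) / 2 + 4 * ε)}) =O[atTop]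
      fun P => P ^ e) :
    (fun P => (outageMI μ S Q P).toReal) =O[atTop] fun P => P ^ e := by
  have hdecay := ((superpolynomialDecay_of_measurePreserving hS.measurePreserving_x hε).add
    (superpolynomialDecay_of_measurePreserving hS.measurePreserving_w₃ hε)).add
    (superpolynomialDecay_pcErr hS hs hL₂ hε)
  refine IsBigO.trans (Eventually.isBigO ?_)
    (((isBigO_rpow_of_superpolynomialDecay hdecay e).add hpc).const_mul_left (ε / 4)⁻¹)
  filter_upwards [hR, eventually_ge_atTop 1, (tendsto_rpow_atTop hε).eventually_ge_atTop Real.pi,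
    (Real.tendsto_log_atTop.const_mul_atTop (show 0 < ε / 4 by positivity)).eventually_ge_atTop
      (Real.log 2)] with P hR hP hPε hlog2
  have hlog : 0 ≤ Real.log P := Real.log_nonneg hP
  have hrate : Q.R P / Q.α ≤ (1 - ε / 4) * ((a + ε) * Real.log P) - Real.log 2 := by
    nlinarith [mul_le_mul_of_nonneg_right haε (mul_nonneg hε.le hlog)]
  rw [Real.norm_of_nonneg ENNReal.toReal_nonneg, ← div_eq_inv_mul, le_div_iff₀' (by positivity)]
  calc ε / 4 * (outageMI μ S Q P).toReal
      ≤ ε / 4 * μ.real {ω | condMutualInfo μ S.x (yd μ S Q P) (pcHat μ S Q P) (pcHat μ S Q P ω) <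
          ENNReal.ofReal ((1 - ε / 4) * ((a + ε) * Real.log P) - Real.log 2)} := by
        gcongr
        exact ENNReal.toReal_mono (measure_ne_top _ _) (outageMI_le hα hrate)
    _ ≤ μ.real {ω | P ^ (-ε - a / 2) <
          ‖S.x ω - symbolEstimate P (pcHat μ S Q P ω) (yd μ S Q P ω)‖} :=
        mul_measureReal_condMutualInfo_lt_le hS.measurePreserving_x hS.measurable_yd
          hS.measurable_pcHat hS.indepFun_pcHat_x (measurable_symbolEstimate P) (by positivity)
          (by positivity) (exp_mul_log_mul_sq_le_one (by positivity) hPε) (by positivity)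
    _ ≤ _ := by
        refine (measureReal_mono (setOf_lt_norm_sub_symbolEstimate_subset hP
          (Real.two_le_pi.trans hPε))).trans ((measureReal_union_le _ _).trans ?_)
        gcongr
        exact (measureReal_union_le _ _).trans (add_le_add (measureReal_union_le _ _) le_rfl)

lemma exists_isBigO_measureReal_norm_pcHat_lt (hS : S.IsRayleigh μ) (hLB : 1 ≤ Q.LB)
    (hL₂ : 1 ≤ Q.L₂) (hs : 0 < Q.s) (hc : 0 < Q.c) {k : ℝ} (hk : 0 < k)
    (hkP : ∀ᶠ P in atTop, k ≤ Q.κ P * (Real.exp (Q.R P / Q.α) - 1)) {a : ℝ} (ha : 0 ≤ a)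
    (ha1 : a < 1) (has : a < Q.s) {d : ℝ} (hd : d < r * (min Q.l Q.s + 1 - a)) :
    ∃ ε > 0, a + ε ≤ 2 ∧
      (fun P => μ.real {ω | ‖pcHat μ S Q P ω‖ < P ^ ((a - 1) / 2 + 4 * ε)}) =O[atTop]
        fun P => P ^ (-d) := by
  have hsmall : ∀ᶠ ε : ℝ in 𝓝[>] 0,
      (1 - min 1 Q.s) / 2 + Q.s * ε + ((a - 1) / 2 + 4 * ε) < 0 := by
    refine nhdsWithin_le_nhds ((Continuous.continuousAt (by fun_prop)).eventually_lt_const ?_)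
    linarith [lt_min ha1 has]
  have hexp : ∀ᶠ ε : ℝ in 𝓝[>] 0,
      2 * r * ((a - 1) / 2 + 4 * ε - min Q.l Q.s / 2 + Q.s * ε) < -d := by
    refine nhdsWithin_le_nhds ((Continuous.continuousAt (by fun_prop)).eventually_lt_const ?_)
    linarith
  obtain ⟨ε, hsmall, hexp, hε, hε1⟩ :=
    (hsmall.and (hexp.and (Ioo_mem_nhdsGT (zero_lt_one' ℝ)))).exists
  refine ⟨ε, hε, by linarith, (isBigO_measureReal_norm_pcHat_lt hS hLB hL₂ hs hc hk hkP hε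
    (by linarith) hsmall).trans (Eventually.isBigO ?_)⟩
  filter_upwards [eventually_ge_atTop 1] with P hP
  rw [Real.norm_of_nonneg (by positivity)]
  exact Real.rpow_le_rpow_of_exponent_le hP hexp.le

lemma le_diversityOrder_outageCAB (hS : S.IsRayleigh μ) (hLB : 1 ≤ Q.LB)
    (hL₂ : 1 ≤ Q.L₂) (hs : 0 < Q.s) (hc : 0 < Q.c) (hα : 0 < Q.α) {k g : ℝ} (hk : 0 < k)
    (hkP : ∀ᶠ P in atTop, k ≤ Q.κ P * (Real.exp (Q.R P / Q.α) - 1)) (hg0 : 0 ≤ g)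
    (hg : g < Q.α) (hgs : g < Q.s * Q.α)
    (hR : Tendsto (fun P => Q.R P / Real.log P) atTop (𝓝 g)) :
    ((r * (min Q.l Q.s + 1 - g / Q.α) : ℝ) : EReal) ≤ diversityOrder (outageCAB μ S Q) := by
  refine le_diversityOrder_of_isBigO (fun P => measure_ne_top _ _) fun d hd => ?_
  obtain ⟨ε, hε, -, hpc⟩ := exists_isBigO_measureReal_norm_pcHat_lt hS hLB hL₂ hs hc hk hkP
    (by positivity) ((div_lt_one hα).2 hg) ((div_lt_iff₀ hα).2 hgs) hd
  exact isBigO_toReal_outageCAB hS hL₂ hs.le hα hε (eventually_div_le_mul_log hε hR) hpc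

lemma le_diversityOrder_outageMI (hS : S.IsRayleigh μ) (hLB : 1 ≤ Q.LB)
    (hL₂ : 1 ≤ Q.L₂) (hs : 0 < Q.s) (hc : 0 < Q.c) (hα : 0 < Q.α) {k g : ℝ} (hk : 0 < k)
    (hkP : ∀ᶠ P in atTop, k ≤ Q.κ P * (Real.exp (Q.R P / Q.α) - 1)) (hg0 : 0 ≤ g)
    (hg : g < Q.α) (hgs : g < Q.s * Q.α)
    (hR : Tendsto (fun P => Q.R P / Real.log P) atTop (𝓝 g)) :
    ((r * (min Q.l Q.s + 1 - g / Q.α) : ℝ) : EReal) ≤ diversityOrder fun P => outageMI μ S Q P := by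
  refine le_diversityOrder_of_isBigO (fun P => measure_ne_top _ _) fun d hd => ?_
  have ha : 0 ≤ g / Q.α := by positivity
  obtain ⟨ε, hε, haε, hpc⟩ := exists_isBigO_measureReal_norm_pcHat_lt hS hLB hL₂ hs hc hk hkP
    ha ((div_lt_one hα).2 hg) ((div_lt_iff₀ hα).2 hgs) hd
  exact isBigO_toReal_outageMI hS hL₂ hs.le hα ha hε haε
    (eventually_div_le_mul_log (by positivity) hR) hpc

end Diversity

end ThreeWay

theorem theorem2_general {Ω : Type*} [MeasurableSpace Ω] (μ : Measure Ω) [IsProbabilityMeasure μ]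
    (r : ℕ) (S : ThreeWay.Signals r Ω) (hS : S.IsRayleigh μ)
    (Lc L₁ LB L₂ : ℕ) (hL₁ : 1 ≤ L₁) (hLB : 1 ≤ LB) (hL₂ : 1 ≤ L₂)
    (l s g : ℝ) (hlr : l ≤ r) (hsr : s < r)
    (hg : g < ThreeWay.dataFraction Lc L₁ LB L₂)
    (hgs : g < s * ThreeWay.dataFraction Lc L₁ LB L₂)
    (R : ℝ → ℝ) (hRpos : ∀ᶠ P in atTop, 0 < R P)
    (hR : Tendsto (fun P => R P / Real.log P) atTop (𝓝 g)) :
    ∃ (c : ℝ) (κ : ℝ → ℝ), 0 < c ∧ (l < r → c = 1) ∧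
      let Q : ThreeWay.Params :=
        { Lc := Lc, L₁ := L₁, LB := LB, L₂ := L₂, l := l, s := s, c := c, κ := κ, R := R }
      let d : ℝ := r * (min l s + 1 - g / ThreeWay.dataFraction Lc L₁ LB L₂)
      (∀ᶠ P in atTop, 0 < κ P ∧ ∫ ω, ThreeWay.txPower μ S Q P ω ∂μ = 1) ∧
      (d : EReal) ≤ ThreeWay.diversityOrder (fun P => ThreeWay.outageCAB μ S Q P) ∧
      (d : EReal) ≤ ThreeWay.diversityOrder (fun P => ThreeWay.outageMI μ S Q P) := by
  have hg0 : 0 ≤ g := ge_of_tendsto hR <| by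
    filter_upwards [hRpos, eventually_gt_atTop 1] with P hRP hP
    exact (div_pos hRP (Real.log_pos hP)).le
  have hα : 0 < ThreeWay.dataFraction Lc L₁ LB L₂ := hg0.trans_lt hg
  have hs : 0 < s := pos_of_mul_pos_left (hg0.trans_lt hgs) hα.le
  obtain ⟨c, κ, k, hc, hc1, hk, hnorm⟩ :=
    ThreeWay.exists_normalization hS hL₁ hLB hlr hs hsr hα hRpos
  have hkP := hnorm.mono fun _ h => h.2.2
  refine ⟨c, κ, hc, hc1, ?_⟩
  intro Q d
  exact ⟨hnorm.mono fun _ h => ⟨h.1, h.2.1⟩,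
    ThreeWay.le_diversityOrder_outageCAB (Q := Q) hS hLB hL₂ hs hc hα hk hkP hg0 hg hgs hR,
    ThreeWay.le_diversityOrder_outageMI (Q := Q) hS hLB hL₂ hs hc hα hk hkP hg0 hg hgs hR⟩

theorem theorem2 {Ω : Type*} [MeasurableSpace Ω] (μ : Measure Ω) [IsProbabilityMeasure μ]
    (r : ℕ) (S : ThreeWay.Signals r Ω) (hS : S.IsRayleigh μ)
    (Lc L₁ LB L₂ : ℕ) (hL₁ : 1 ≤ L₁) (hLB : 1 ≤ LB) (hL₂ : 1 ≤ L₂)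
    (l s g : ℝ) (hl0 : 0 ≤ l) (hlr : l ≤ r) (hs1 : 1 ≤ s) (hsr : s < r)
    (hg0 : 0 ≤ g) (hg : g < ThreeWay.dataFraction Lc L₁ LB L₂)
    (R : ℝ → ℝ) (hRpos : ∀ᶠ P in atTop, 0 < R P)
    (hR : Tendsto (fun P => R P / Real.log P) atTop (𝓝 g)) :
    ∃ (c : ℝ) (κ : ℝ → ℝ), 0 < c ∧ (l < r → c = 1) ∧
      let Q : ThreeWay.Params :=
        { Lc := Lc, L₁ := L₁, LB := LB, L₂ := L₂, l := l, s := s, c := c, κ := κ, R := R }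
      let d : ℝ := r * (min l s + 1 - g / ThreeWay.dataFraction Lc L₁ LB L₂)
      (∀ᶠ P in atTop, 0 < κ P ∧ ∫ ω, ThreeWay.txPower μ S Q P ω ∂μ = 1) ∧
      (d : EReal) ≤ ThreeWay.diversityOrder (fun P => ThreeWay.outageCAB μ S Q P) ∧
      (d : EReal) ≤ ThreeWay.diversityOrder (fun P => ThreeWay.outageMI μ S Q P) :=
  theorem2_general μ r S hS Lc L₁ LB L₂ hL₁ hLB hL₂ l s g hlr hsr hg
    (hg.trans_le (le_mul_of_one_le_left (hg0.trans hg.le) hs1)) R hRpos hR
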